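/- Notation. For $f\in C_0^\infty(\mathbb R;\mathbb R)$ put $\hat f(E)=\frac1{\sqrt{2\pi}}\int_{\mathbb R}f(u)e^{iEu}\,du$. Let $\mathcal H^{(1)}=L^2(\mathbb R_+,E\,dE)$ (the one-particle space of the $U(1)$-current in momentum space), and for $c_1<c_2$ in $\mathbb R\cup\{\pm\infty\}$ let $H^{(1)}(c_1,c_2)\subset\mathcal H^{(1)}$ be the norm closure of $\{\hat f|_{\mathbb R_+}: f\in C_0^\infty(\mathbb R;\mathbb R),\ \operatorname{supp}f\subset(c_1,c_2)\}$. Let $\Im^+=\mathbb R\times\mathbb S^2$ with points $(u,\boldsymbol n)$, let $d\mathbb S^2$ be the surface measure of the unit sphere, and let $$\mathcal H=L^2(\mathbb R_+\times\mathbb S^2,E\,dE\,d\mathbb S^2)\simeq\int^{\oplus}_{\mathbb S^2}\mathcal H^{(1)}\,d\mathbb S^2,\qquad \xi\mapsto\big(\xi(\cdot,\boldsymbol n)\big)_{\boldsymbol n\in\mathbb S^2}.$$ For open $\mathsf O\subset\Im^+$ let $H(\mathsf O)\subset\mathcal H$ be the norm closure of the set of all $\hat\psi$, where $\psi\in C_0^\infty(\Im^+;\mathbb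 R)$, $\operatorname{supp}\psi\subset\mathsf O$, and $\hat\psi(\cdot,\boldsymbol n)$ is the Fourier transform of $\psi(\cdot,\boldsymbol n)$. For a family of closed real subspaces $K_{\boldsymbol n}\subset\mathcal H^{(1)}$, $\boldsymbol n\in A$, the statement $H=\int_A^{\oplus_{\mathbb R}}K_{\boldsymbol n}\,d\mathbb S^2$ means that $H$ consists of exactly those $\xi\in\mathcal H$ with $\xi(\cdot,\boldsymbol n)\in K_{\boldsymbol n}$ for a.e. $\boldsymbol n\in A$ and $\xi(\cdot,\boldsymbol n)=0$ for a.e. $\boldsymbol n\notin A$, and that the field $(K_{\boldsymbol n})$ is measurable: there are $\xi_k\in H$, $k\in\mathbb N$, such that for a.e. $\boldsymbol n\in A$ the space $K_{\boldsymbol n}$ is the closed real linear span of $\{\xi_k(\cdot,\boldsymbol n)\}_k$. A closed real subspace $H$ is separating if $H\cap iH=\{0\}$, cyclic if $H+iH$ is dense, and standard if it is both. For $C\in C^0(\mathbb S^2;\mathbb R)$ put $\mathsf O+C=\{(u+C(\boldsymbol n),\boldsymbol n):(u,\boldsymbol n)\in\mathsf O\}$ and $\mathsf S_C=\{(u,\boldsymbol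 n):C(\boldsymbol n)<u\}$, and let $T_C$ be the unitary operator on $\mathcal H$ given by $(T_C\xi)(E,\boldsymbol n)=e^{iEC(\boldsymbol n)}\xi(E,\boldsymbol n)$, that is, by $(T_C\psi)(u,\boldsymbol n)=\psi(u-C(\boldsymbol n),\boldsymbol n)$ on functions on $\Im^+$. **Statement.** Let $c_1,c_2\in\mathbb R\cup\{\pm\infty\}$ with $c_1<c_2$, let $A\subset\mathbb S^2$ be open, let $\mathsf R=(c_1,c_2)\times A\subset\Im^+$, and let $C\in C^0(\mathbb S^2;\mathbb R)$. 1. One has $$H(\mathsf R)=\int_A^{\oplus_{\mathbb R}}H^{(1)}(c_1,c_2)\,d\mathbb S^2 .$$ If $(c_1,c_2)\neq\mathbb R$, then $H(\mathsf R)$ is separating; if moreover $\mathbb S^2\setminus A$ is a null set, then $H(\mathsf R)$ is standard. 2. One has $$H(\mathsf R+C)=\int_A^{\oplus_{\mathbb R}}H^{(1)}\big(c_1+C(\boldsymbol n),c_2+C(\boldsymbol n)\big)\,d\mathbb S^2(\boldsymbol n).$$ If $(c_1,c_2)\neq\mathbb R$, then $H(\mathsf R+C)$ is separating; if moreover $\mathbb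 S^2\setminus A$ is a null set, then $H(\mathsf R+C)$ is standard. 3. In particular, $$H(\mathsf S_C)=T_C\,H\big((0,+\infty)\times\mathbb S^2\big)=\int_{\mathbb S^2}^{\oplus_{\mathbb R}}H^{(1)}\big(C(\boldsymbol n),+\infty\big)\,d\mathbb S^2(\boldsymbol n),$$ and this is a standard subspace. -/

import Mathlib

open MeasureTheory Set
open scoped ENNReal ContDiff Manifold

noncomputable section

namespace Scri

/-! ### Real subspaces of a complex Hilbert space -/

section RealSubspaces

variable {𝓚 : Type*} [AddCommGroup 𝓚] [Module ℝ 𝓚] [Module ℂ 𝓚]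

/-- `H` is separating: `H ∩ iH = {0}`. -/
def IsSeparating (H : Submodule ℝ 𝓚) : Prop :=
  ∀ x ∈ H, ∀ y ∈ H, x = Complex.I • y → x = 0

/-- `H` is cyclic: `H + iH` is dense. -/
def IsCyclic [TopologicalSpace 𝓚] (H : Submodule ℝ 𝓚) : Prop :=
  Dense {z : 𝓚 | ∃ x ∈ H, ∃ y ∈ H, z = x + Complex.I • y}

/-- `H` is a standard subspace: closed, cyclic and separating. -/
def IsStandard [TopologicalSpace 𝓚] (H : Submodule ℝ 𝓚) : Prop :=
  IsClosed (H : Set 𝓚) ∧ IsCyclic H ∧ IsSeparating H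

end RealSubspaces

/-! ### Null infinity and the one-particle Hilbert spaces -/

/-- The unit two-sphere in Euclidean three-space. -/
abbrev S2 : Type := Metric.sphere (0 : EuclideanSpace ℝ (Fin 3)) 1

/-- Future null infinity `ℝ × S²`, in a Bondi frame. -/
abbrev ScriPlus : Type := ℝ × S2

/-- The standard surface measure of the unit sphere. -/
def sphereMeasure : Measure S2 := (volume : Measure (EuclideanSpace ℝ (Fin 3))).toSphere

/-- The measure `E dE` on the half-line `(0, ∞)`. -/
def energyMeasure : Measure ℝ :=
  (volume.restrict (Ioi (0 : ℝ))).withDensity fun E => ENNReal.ofReal E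

/-- The product measure `E dE dS²`. -/
def momentumMeasure : Measure (ℝ × S2) := energyMeasure.prod sphereMeasure

/-- The one-particle space of the `U(1)`-current, in momentum space: `L²(ℝ₊, E dE)`. -/
abbrev CurrentSpace : Type := Lp ℂ 2 energyMeasure

/-- The one-particle space on null infinity, in momentum space: `L²(ℝ₊ × S², E dE dS²)`. -/
abbrev ScriSpace : Type := Lp ℂ 2 momentumMeasure

/-- `f̂(E) = (2π)^{-1/2} ∫ f(u) e^{iEu} du`. -/
def fourier (f : ℝ → ℝ) (E : ℝ) : ℂ :=
  ((Real.sqrt (2 * Real.pi))⁻¹ : ℝ) * ∫ u : ℝ, (f u : ℂ) * Complex.exp (Complex.I * E * u)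

/-- The Fourier transform in the variable `u` of a function on null infinity. -/
def scriFourier (ψ : ScriPlus → ℝ) (p : ℝ × S2) : ℂ :=
  fourier (fun u => ψ (u, p.2)) p.1

/-- Real-valued smooth functions on the line with compact support inside `I`. -/
def IsTestOnLine (I : Set ℝ) (f : ℝ → ℝ) : Prop :=
  ContDiff ℝ ∞ f ∧ HasCompactSupport f ∧ tsupport f ⊆ I

/-- Real-valued smooth functions on null infinity with compact support inside `O`. -/
def IsTestOnScri (O : Set ScriPlus) (ψ : ScriPlus → ℝ) : Prop :=
  ContMDiff ((𝓘(ℝ, ℝ)).prod (𝓡 2)) 𝓘(ℝ, ℝ) ∞ ψ ∧ HasCompactSupport ψ ∧ tsupport ψ ⊆ O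

theorem integrable_fourier {f : ℝ → ℝ} (hf : Continuous f) (hc : HasCompactSupport f) (E : ℝ) :
    Integrable fun u : ℝ => (f u : ℂ) * Complex.exp (Complex.I * E * u) := by
  apply Continuous.integrable_of_hasCompactSupport
  · fun_prop
  · exact HasCompactSupport.mul_right (hc.comp_left (g := fun x : ℝ => (x : ℂ)) (by simp))

theorem fourier_add {f g : ℝ → ℝ} (hf : Continuous f) (hfc : HasCompactSupport f)
    (hg : Continuous g) (hgc : HasCompactSupport g) (E : ℝ) :
    fourier (fun u => f u + g u) E = fourier f E + fourier g E := by
  unfold fourier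
  rw [← mul_add, ← integral_add (integrable_fourier hf hfc E) (integrable_fourier hg hgc E)]
  simp [add_mul]

theorem fourier_smul (c : ℝ) (f : ℝ → ℝ) (E : ℝ) :
    fourier (fun u => c * f u) E = c • fourier f E := by
  unfold fourier
  simp only [Complex.ofReal_mul, mul_assoc, integral_const_mul, Complex.real_smul]
  ring

theorem fourier_zero (E : ℝ) : fourier (fun _ => 0) E = 0 := by
  simp [fourier]

theorem slice_continuous {ψ : ScriPlus → ℝ} (h : Continuous ψ) (n : S2) :
    Continuous fun u : ℝ => ψ (u, n) := by fun_prop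

theorem slice_hasCompactSupport {ψ : ScriPlus → ℝ} (h : HasCompactSupport ψ) (n : S2) :
    HasCompactSupport fun u : ℝ => ψ (u, n) := by
  refine HasCompactSupport.intro (K := Prod.fst '' tsupport ψ) (h.isCompact.image continuous_fst) ?_
  intro u hu
  by_contra hne
  exact hu ⟨(u, n), subset_tsupport _ hne, rfl⟩

/-- The real vector space of (momentum space classes of) test functions supported in `I`. -/
def currentTestSpace (I : Set ℝ) : Submodule ℝ CurrentSpace where
  carrier := {ξ | ∃ f : ℝ → ℝ, IsTestOnLine I f ∧ ξ =ᵐ[energyMeasure] fourier f}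
  zero_mem' := by
    refine ⟨fun _ => 0, ⟨contDiff_const, HasCompactSupport.zero, ?_⟩, ?_⟩
    · simp [tsupport]
    · filter_upwards [Lp.coeFn_zero ℂ 2 energyMeasure] with E hE
      rw [hE, Pi.zero_apply, fourier_zero]
  add_mem' := by
    rintro ξ η ⟨f, ⟨hf, hfc, hfs⟩, hξ⟩ ⟨g, ⟨hg, hgc, hgs⟩, hη⟩
    refine ⟨fun u => f u + g u, ⟨hf.add hg, hfc.add hgc,
      (tsupport_add f g).trans (union_subset hfs hgs)⟩, ?_⟩
    filter_upwards [Lp.coeFn_add ξ η, hξ, hη] with E h1 h2 h3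
    rw [h1, Pi.add_apply, h2, h3, fourier_add hf.continuous hfc hg.continuous hgc]
  smul_mem' := by
    rintro c ξ ⟨f, ⟨hf, hfc, hfs⟩, hξ⟩
    refine ⟨fun u => c * f u, ⟨contDiff_const.mul hf, hfc.mul_left,
      (closure_mono (Function.support_mul_subset_right _ _)).trans hfs⟩, ?_⟩
    filter_upwards [Lp.coeFn_smul c ξ, hξ] with E h1 h2
    rw [h1, Pi.smul_apply, h2, fourier_smul]

/-- The real vector space of (momentum space classes of) test functions supported in `O`. -/
def scriTestSpace (O : Set ScriPlus) : Submodule ℝ ScriSpace where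
  carrier := {ξ | ∃ ψ : ScriPlus → ℝ, IsTestOnScri O ψ ∧ ξ =ᵐ[momentumMeasure] scriFourier ψ}
  zero_mem' := by
    refine ⟨fun _ => 0, ⟨contMDiff_const, HasCompactSupport.zero, ?_⟩, ?_⟩
    · simp [tsupport]
    · filter_upwards [Lp.coeFn_zero ℂ 2 momentumMeasure] with p hp
      rw [hp, Pi.zero_apply, scriFourier, fourier_zero]
  add_mem' := by
    rintro ξ η ⟨f, ⟨hf, hfc, hfs⟩, hξ⟩ ⟨g, ⟨hg, hgc, hgs⟩, hη⟩
    refine ⟨fun u => f u + g u, ⟨hf.add hg, hfc.add hgc,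
      (tsupport_add f g).trans (union_subset hfs hgs)⟩, ?_⟩
    filter_upwards [Lp.coeFn_add ξ η, hξ, hη] with p h1 h2 h3
    rw [h1, Pi.add_apply, h2, h3]
    exact (fourier_add (slice_continuous hf.continuous p.2) (slice_hasCompactSupport hfc p.2)
      (slice_continuous hg.continuous p.2) (slice_hasCompactSupport hgc p.2) p.1).symm
  smul_mem' := by
    rintro c ξ ⟨f, ⟨hf, hfc, hfs⟩, hξ⟩
    refine ⟨fun u => c * f u, ⟨contMDiff_const.mul hf, hfc.mul_left,
      (closure_mono (Function.support_mul_subset_right _ _)).trans hfs⟩, ?_⟩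
    filter_upwards [Lp.coeFn_smul c ξ, hξ] with p h1 h2
    rw [h1, Pi.smul_apply, h2]
    exact (fourier_smul c (fun u => f (u, p.2)) p.1).symm

/-- The open interval of the real line with end points in `ℝ ∪ {±∞}`. -/
def interval (c₁ c₂ : EReal) : Set ℝ := {u | c₁ < (u : EReal) ∧ (u : EReal) < c₂}

/-- The local real subspace `H⁽¹⁾(c₁, c₂)` of the `U(1)`-current. -/
def currentSubspace (c₁ c₂ : EReal) : Submodule ℝ CurrentSpace :=
  (currentTestSpace (interval c₁ c₂)).topologicalClosure

/-- The local real subspace `H(O)` on null infinity. -/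
def scriSubspace (O : Set ScriPlus) : Submodule ℝ ScriSpace :=
  (scriTestSpace O).topologicalClosure

/-- The region `(c₁, c₂) × A`. -/
def strip (c₁ c₂ : EReal) (A : Set S2) : Set ScriPlus := interval c₁ c₂ ×ˢ A

/-- The translated region `O + C`. -/
def shift (C : S2 → ℝ) (O : Set ScriPlus) : Set ScriPlus :=
  (fun p : ScriPlus => (p.1 + C p.2, p.2)) '' O

/-- The positive half-strip `{(u, n) : C(n) < u}`. -/
def halfStrip (C : S2 → ℝ) : Set ScriPlus := {p | C p.2 < p.1}

/-! ### Direct integrals over the sphere -/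

open Classical in
/-- The component `ξ(n) = ξ(·, n)` of `ξ ∈ L²(ℝ₊ × S²) ≃ ∫^⊕ L²(ℝ₊) dS²`; by Fubini's theorem the
first alternative holds for almost every `n`. -/
def component (ξ : ScriSpace) (n : S2) : CurrentSpace :=
  if h : MemLp (fun E => ξ (E, n)) 2 energyMeasure then h.toLp (fun E => ξ (E, n)) else 0

/-- `H = ∫_A^{⊕ℝ} K(n) dS²(n)` as a real subspace of `∫^⊕ L²(ℝ₊, E dE) dS²`: the family
`(K(n))_{n ∈ A}` is a measurable field of closed real subspaces (it has a fundamental sequence of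
measurable sections, in `H`), and `H` consists of all square integrable sections of this field,
extended by zero outside `A`. -/
def IsRealDirectIntegral (A : Set S2) (K : S2 → Submodule ℝ CurrentSpace)
    (H : Submodule ℝ ScriSpace) : Prop :=
  (∃ e : ℕ → ScriSpace, (∀ k, e k ∈ H) ∧ ∀ᵐ n ∂sphereMeasure, n ∈ A →
    K n = (Submodule.span ℝ (range fun k => component (e k) n)).topologicalClosure) ∧
  ∀ ξ : ScriSpace, ξ ∈ H ↔ ∀ᵐ n ∂sphereMeasure,
    (n ∈ A → component ξ n ∈ K n) ∧ (n ∉ A → component ξ n = 0)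

/-! ### Distorted translations -/

/-- The phase `e^{iE C(n)}`, by which the translation `u ↦ u + C(n)` acts in momentum space. -/
def phase (C : S2 → ℝ) (p : ℝ × S2) : ℂ := Complex.exp (Complex.I * p.1 * C p.2)

/-- In configuration space multiplication by the phase is `ψ(u, n) ↦ ψ(u - C(n), n)`. -/
theorem scriFourier_translate (C : S2 → ℝ) (ψ : ScriPlus → ℝ) (p : ℝ × S2) :
    scriFourier (fun q => ψ (q.1 - C q.2, q.2)) p = phase C p * scriFourier ψ p := by
  simp only [scriFourier, fourier, phase]
  have h := integral_sub_right_eq_self (μ := volume) (fun u : ℝ => (ψ (u, p.2) : ℂ) *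
    Complex.exp (Complex.I * p.1 * u)) (C p.2)
  rw [← h, mul_left_comm (Complex.exp _), ← integral_const_mul (Complex.exp _)]
  congr 2
  funext u
  rw [mul_left_comm, ← Complex.exp_add]
  push_cast
  ring_nf

theorem norm_phase (C : S2 → ℝ) (p : ℝ × S2) : ‖phase C p‖ = 1 := by
  rw [phase, show Complex.I * p.1 * C p.2 = ((p.1 * C p.2 : ℝ) : ℂ) * Complex.I by
    push_cast; ring]
  exact Complex.norm_exp_ofReal_mul_I _

theorem phase_neg_mul (C : S2 → ℝ) (p : ℝ × S2) : phase (-C) p * phase C p = 1 := by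
  rw [phase, phase, ← Complex.exp_add]
  simp

theorem memLp_phase_mul (C : C(S2, ℝ)) (ξ : ScriSpace) :
    MemLp (fun p => phase C p * ξ p) 2 momentumMeasure := by
  refine (Lp.memLp ξ).of_le ?_ (Filter.Eventually.of_forall fun p => ?_)
  · have : Continuous (phase C) := by unfold phase; fun_prop
    exact this.aestronglyMeasurable.mul (Lp.aestronglyMeasurable ξ)
  · simp [norm_phase]

/-- The distorted translation `(T_C ξ)(u, n) = ξ(u - C(n), n)`, a unitary operator. -/
def translation (C : C(S2, ℝ)) : ScriSpace ≃ₗᵢ[ℂ] ScriSpace where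
  toFun ξ := (memLp_phase_mul C ξ).toLp
  invFun ξ := (memLp_phase_mul (-C) ξ).toLp
  map_add' ξ η := by
    apply Lp.ext
    filter_upwards [(memLp_phase_mul C (ξ + η)).coeFn_toLp, (memLp_phase_mul C ξ).coeFn_toLp,
      (memLp_phase_mul C η).coeFn_toLp, Lp.coeFn_add ξ η,
      Lp.coeFn_add (memLp_phase_mul C ξ).toLp (memLp_phase_mul C η).toLp] with p h1 h2 h3 h4 h5
    rw [h1, h5, Pi.add_apply, h2, h3, h4, Pi.add_apply, mul_add]
  map_smul' c ξ := by
    apply Lp.ext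
    filter_upwards [(memLp_phase_mul C (c • ξ)).coeFn_toLp, (memLp_phase_mul C ξ).coeFn_toLp,
      Lp.coeFn_smul c ξ, Lp.coeFn_smul c (memLp_phase_mul C ξ).toLp] with p h1 h2 h3 h4
    rw [RingHom.id_apply, h1, h4, Pi.smul_apply, h2, h3, Pi.smul_apply, smul_eq_mul, smul_eq_mul,
      mul_left_comm]
  left_inv ξ := by
    apply Lp.ext
    filter_upwards [(memLp_phase_mul (-C) (memLp_phase_mul C ξ).toLp).coeFn_toLp,
      (memLp_phase_mul C ξ).coeFn_toLp] with p h1 h2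
    rw [h1, h2, ← mul_assoc, ContinuousMap.coe_neg, phase_neg_mul, one_mul]
  right_inv ξ := by
    apply Lp.ext
    filter_upwards [(memLp_phase_mul C (memLp_phase_mul (-C) ξ).toLp).coeFn_toLp,
      (memLp_phase_mul (-C) ξ).coeFn_toLp] with p h1 h2
    rw [h1, h2, ← mul_assoc, ContinuousMap.coe_neg, mul_comm (phase C p), phase_neg_mul, one_mul]
  norm_map' ξ := by
    refine (Lp.norm_toLp _ (memLp_phase_mul C ξ)).trans ?_
    rw [Lp.norm_def]
    congr 1
    exact eLpNorm_congr_norm_ae (Filter.Eventually.of_forall fun p => by simp [norm_phase])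

end Scri

end

open Scri

noncomputable section

namespace Scri

/-! Everything reduces to single light rays. For an open region `O` whose slices are intervals, a
vector lies in `H(O)` if and only if almost all its components lie in the one-particle subspaces
`fibre O n` of the slices (`mem_scriSubspace_iff`). Components survive closures, because L²
convergence gives almost everywhere convergence along a subsequence. Conversely, the part of a
vector orthogonal to `H(O)` is orthogonal to all products of test functions. By the fundamental
lemma on the sphere and a countable family of rational intervals, its components are orthogonal to
the fibres (`component_mem_orthogonal`). If the components also lie in the fibres, they vanish.

The criterion applies directly to `R + C`, which is open with interval slices. This matters because
`C` is only continuous, so translating a test function by it can destroy smoothness.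

The other properties are fibrewise. By positivity of the energy, a transform vanishing near a real
point vanishes identically, so test functions in any non-empty open set are total
(`eq_zero_of_orthogonal_test`); this gives cyclicity. The imaginary part of the inner product is a
multiple of `∫ f g'`, hence zero for disjoint supports (`im_integral_fourier_eq_zero`). With
totality on an open set missed by the interval, this gives separation. -/

/-! ### Boundary uniqueness on the upper half-plane -/

/-- A function on the closed upper half-plane vanishing on a real interval around `0` vanishes at
`is` for small `s`: the product of its four rotates about `is` vanishes on the boundary of a
square. -/
theorem apply_I_mul_eq_zero_of_vanish {Φ : ℂ → ℂ} {δ s : ℝ}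
    (hc : ContinuousOn Φ {z | 0 ≤ z.im}) (hd : DifferentiableOn ℂ Φ {z | 0 < z.im})
    (hz : ∀ t : ℝ, |t| < δ → Φ t = 0) (hs : 0 < s) (hsδ : s < δ) :
    Φ (Complex.I * s) = 0 := by
  -- In the coordinate `w` about `is`, the square touches the real axis along one edge only. Each of
  -- the four rotations `a` brings a different edge there, inside `(-δ, δ)`, and at `w = 0` the
  -- product is the fourth power of `Φ(is)`.
  set U : Set ℂ := Ioo (-s) s ×ℂ Ioo (-s) s with hU
  have hclos : closure U = Icc (-s) s ×ℂ Icc (-s) s := by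
    rw [hU, Complex.closure_reProdIm, closure_Ioo (by linarith)]
  have hopen : IsOpen U := isOpen_Ioo.reProdIm isOpen_Ioo
  have hbdd : Bornology.IsBounded U :=
    (Metric.isBounded_Ioo _ _).reProdIm (Metric.isBounded_Ioo _ _)
  have fac : ∀ a : ℂ, (a = 1 ∨ a = Complex.I ∨ a = -1 ∨ a = -Complex.I) →
      DiffContOnCl ℂ (fun w => Φ (Complex.I * s + a * w)) U := by
    intro a ha
    constructor
    · refine hd.comp (by fun_prop) ?_
      rintro w ⟨⟨h1, h2⟩, h3, h4⟩
      rcases ha with rfl | rfl | rfl | rfl <;> simp <;> linarith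
    · refine hc.comp (by fun_prop) ?_
      rw [hclos]
      rintro w ⟨⟨h1, h2⟩, h3, h4⟩
      rcases ha with rfl | rfl | rfl | rfl <;> simp <;> linarith
  have hP := (((fac 1 (by simp)).smul (fac Complex.I (by simp))).smul
    (fac (-1) (by simp))).smul (fac (-Complex.I) (by simp))
  have hE := Complex.eqOn_of_eqOn_frontier hbdd hP (diffContOnCl_const (c := (0 : ℂ))) ?_
  · have := hE (x := 0) ⟨by simp [hs], by simp [hs]⟩
    simpa using this
  · intro w hw
    rw [hopen.frontier_eq, hclos] at hw
    obtain ⟨⟨⟨h1, h2⟩, h3, h4⟩, hn⟩ := hw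
    have key : ∀ a : ℂ, (Complex.I * s + a * w).im = 0 → |(Complex.I * s + a * w).re| < δ →
        Φ (Complex.I * s + a * w) = 0 := by
      intro a h1 h2
      have : Complex.I * s + a * w = ((Complex.I * s + a * w).re : ℂ) :=
        Complex.ext (by simp) (by simp [h1])
      rw [this]
      exact hz _ h2
    have hre : |w.re| < δ := (abs_le.2 ⟨h1, h2⟩).trans_lt hsδ
    have him : |w.im| < δ := (abs_le.2 ⟨h3, h4⟩).trans_lt hsδ
    have : w.re = s ∨ w.re = -s ∨ w.im = s ∨ w.im = -s := by
      by_contra! hne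
      exact hn ⟨⟨lt_of_le_of_ne h1 (Ne.symm hne.2.1), lt_of_le_of_ne h2 hne.1⟩,
        lt_of_le_of_ne h3 (Ne.symm hne.2.2.2), lt_of_le_of_ne h4 hne.2.2.1⟩
    simp only [smul_eq_mul, mul_eq_zero]
    rcases this with h | h | h | h
    · exact Or.inr (key (-Complex.I) (by simp [h]) (by simpa using him))
    · exact Or.inl (Or.inl (Or.inr (key Complex.I (by simp [h]) (by simpa using him))))
    · exact Or.inl (Or.inr (key (-1) (by simp [h]) (by simpa using hre)))
    · exact Or.inl (Or.inl (Or.inl (key 1 (by simp [h]) (by simpa using hre))))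

/-- The zeros `is`, `0 < s < δ`, accumulate at the interior point `iδ/2`, so the identity theorem
applies; continuity then reaches the real axis. -/
theorem eqOn_zero_of_vanish_near {Φ : ℂ → ℂ} {δ : ℝ} (hδ : 0 < δ)
    (hc : ContinuousOn Φ {z | 0 ≤ z.im}) (hd : DifferentiableOn ℂ Φ {z | 0 < z.im})
    (hz : ∀ t : ℝ, |t| < δ → Φ t = 0) : EqOn Φ 0 {z | 0 ≤ z.im} := by
  have hopen : IsOpen {z : ℂ | 0 < z.im} := isOpen_lt continuous_const Complex.continuous_im
  have h1 : EqOn Φ 0 {z | 0 < z.im} := by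
    refine AnalyticOnNhd.eqOn_zero_of_preconnected_of_frequently_eq_zero
      (z₀ := Complex.I * ((δ / 2 : ℝ) : ℂ)) (hd.analyticOnNhd hopen)
      (convex_halfSpace_im_gt 0).isPreconnected (by simp; positivity) ?_
    have ht : Filter.Tendsto (fun s : ℝ => Complex.I * (s : ℂ)) (nhdsWithin (δ / 2) {δ / 2}ᶜ)
        (nhdsWithin (Complex.I * ((δ / 2 : ℝ) : ℂ)) {Complex.I * ((δ / 2 : ℝ) : ℂ)}ᶜ) := by
      refine tendsto_nhdsWithin_iff.2 ⟨?_, ?_⟩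
      · exact ((by fun_prop : Continuous fun s : ℝ => Complex.I * (s : ℂ)).tendsto _).mono_left
          nhdsWithin_le_nhds
      · filter_upwards [self_mem_nhdsWithin] with s hs
        simpa [← Complex.ofReal_ofNat, ← Complex.ofReal_div] using hs
    refine ht.frequently (Filter.Eventually.frequently ?_)
    filter_upwards [nhdsWithin_le_nhds (Ioo_mem_nhds (by linarith : (0 : ℝ) < δ / 2)
      (by linarith : δ / 2 < δ))] with s hs
    exact apply_I_mul_eq_zero_of_vanish hc hd hz hs.1 hs.2
  refine h1.of_subset_closure hc continuousOn_const (fun z (hz : 0 < z.im) => show 0 ≤ z.im from hz.le) ?_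
  rw [Complex.closure_setOfPred_lt_im]

/-! ### Fourier transforms of half-line densities -/

theorem norm_exp_I_mul (E : ℝ) (z : ℂ) :
    ‖Complex.exp (Complex.I * E * z)‖ = Real.exp (-(E * z.im)) := by
  rw [Complex.norm_exp]; simp

theorem continuousOn_laplace {μ : Measure ℝ} (hμ : ∀ᵐ E ∂μ, 0 ≤ E) {h : ℝ → ℂ}
    (hh : Integrable h μ) :
    ContinuousOn (fun z : ℂ => ∫ E, h E * Complex.exp (Complex.I * E * z) ∂μ)
      {z | 0 ≤ z.im} := by
  refine continuousOn_of_dominated (bound := fun E => ‖h E‖) (fun z _ => ?_) (fun z hz => ?_)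
    hh.norm (.of_forall fun E => by fun_prop)
  · exact hh.1.mul (by fun_prop : Continuous _).aestronglyMeasurable
  · filter_upwards [hμ] with E hE
    rw [norm_mul, norm_exp_I_mul]
    exact mul_le_of_le_one_right (norm_nonneg _)
      (Real.exp_le_one_iff.2 (neg_nonpos.2 (mul_nonneg hE hz)))

theorem differentiableOn_laplace {μ : Measure ℝ} (hμ : ∀ᵐ E ∂μ, 0 ≤ E) {h : ℝ → ℂ}
    (hh : Integrable h μ) :
    DifferentiableOn ℂ (fun z : ℂ => ∫ E, h E * Complex.exp (Complex.I * E * z) ∂μ)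
      {z | 0 < z.im} := by
  intro z hz
  have hz' : 0 < z.im := hz
  have hmeas : ∀ z : ℂ, AEStronglyMeasurable
      (fun E : ℝ => h E * Complex.exp (Complex.I * E * z)) μ := fun z =>
    hh.1.mul (by fun_prop : Continuous _).aestronglyMeasurable
  have hs : {w : ℂ | z.im / 2 < w.im} ∈ nhds z :=
    (isOpen_lt continuous_const Complex.continuous_im).mem_nhds (by simp; linarith)
  refine (hasDerivAt_integral_of_dominated_loc_of_deriv_le (x₀ := z)
    (F' := fun z E => h E * (Complex.exp (Complex.I * E * z) * (Complex.I * E)))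
    (bound := fun E => ‖h E‖ * (z.im / 2)⁻¹) hs (.of_forall hmeas) ?_ ?_ ?_
    (hh.norm.mul_const _) (.of_forall fun E w _ => ?_)).2.differentiableAt.differentiableWithinAt
  · refine hh.mono (hmeas z) ?_
    filter_upwards [hμ] with E hE
    rw [norm_mul, norm_exp_I_mul]
    exact mul_le_of_le_one_right (norm_nonneg _)
      (Real.exp_le_one_iff.2 (neg_nonpos.2 (mul_nonneg hE hz'.le)))
  · exact hh.1.mul (by fun_prop : Continuous _).aestronglyMeasurable
  · filter_upwards [hμ] with E hE w hw
    have hw' : z.im / 2 < w.im := hw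
    rw [norm_mul, norm_mul, norm_exp_I_mul]
    refine mul_le_mul_of_nonneg_left ?_ (norm_nonneg _)
    -- The factor `E` from differentiation is absorbed by the decay `exp(-E Im w)`, uniformly for
    -- `Im w > Im z / 2`.
    have h1 : E * (z.im / 2) ≤ Real.exp (E * w.im) := by
      nlinarith [Real.add_one_le_exp (E * w.im)]
    rw [Real.exp_neg, inv_mul_le_iff₀ (Real.exp_pos _), le_mul_inv_iff₀ (by positivity)]
    simpa [abs_of_nonneg hE] using h1
  · refine HasDerivAt.const_mul _ (HasDerivAt.cexp ?_)
    simpa using (hasDerivAt_id w).const_mul (Complex.I * (E : ℂ))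

/-- Uniqueness of the Fourier transform of an integrable function. -/
theorem ae_eq_zero_of_fourier_eq_zero {μ : Measure ℝ} [SigmaFinite μ] {h : ℝ → ℂ}
    (hh : Integrable h μ)
    (hz : ∀ t : ℝ, ∫ E, h E * Complex.exp (Complex.I * E * t) ∂μ = 0) : h =ᵐ[μ] 0 := by
  refine ae_eq_zero_of_integral_contDiff_smul_eq_zero hh.locallyIntegrable fun g hg hgc => ?_
  have hgc' : HasCompactSupport fun x => (g x : ℂ) := hgc.comp_left (g := fun x : ℝ => (x : ℂ)) rfl
  set G : SchwartzMap ℝ ℂ :=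
    hgc'.toSchwartzMap (Complex.ofRealCLM.contDiff.comp hg) with hG
  set F : SchwartzMap ℝ ℂ := FourierTransform.fourierInv G with hF
  have hFG : FourierTransform.fourier F = G := by rw [hF, FourierTransform.fourier_fourierInv_eq]
  -- Moving the Fourier transform from `h` to `F` turns the pairing of `h` with the arbitrary test
  -- function `g` into an integral against the transform of `h`, which is zero.
  have key := VectorFourier.integral_fourierIntegral_smul_eq_flip (μ := μ) (ν := volume)
    (L := innerₗ ℝ) (f := h) (g := F) Real.continuous_fourierChar continuous_inner hh F.integrable
  have h0 : ∀ ξ, VectorFourier.fourierIntegral Real.fourierChar μ (innerₗ ℝ) h ξ = 0 := by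
    intro ξ
    rw [VectorFourier.fourierIntegral, ← hz (-(2 * Real.pi * ξ))]
    congr 1
    ext v
    rw [Circle.smul_def, Real.fourierChar_apply, smul_eq_mul, mul_comm]
    congr 2
    simp
    ring
  have h1 : ∀ x, VectorFourier.fourierIntegral Real.fourierChar volume (innerₗ ℝ).flip F x
      = (g x : ℂ) := by
    intro x
    have h2 : FourierTransform.fourier F x = (g x : ℂ) := by rw [hFG]; rfl
    rw [← h2, flip_innerₗ]
    rfl
  simp only [h0, h1, zero_smul, integral_zero] at key
  rw [key]
  congr 1
  ext x
  simp [mul_comm]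

theorem ae_eq_zero_of_fourier_eq_zero_near {μ : Measure ℝ} [SigmaFinite μ]
    (hμ : ∀ᵐ E ∂μ, 0 ≤ E) {h : ℝ → ℂ} (hh : Integrable h μ) {δ : ℝ} (hδ : 0 < δ)
    (hz : ∀ t : ℝ, |t| < δ → ∫ E, h E * Complex.exp (Complex.I * E * t) ∂μ = 0) :
    h =ᵐ[μ] 0 :=
  ae_eq_zero_of_fourier_eq_zero hh fun t =>
    eqOn_zero_of_vanish_near hδ (continuousOn_laplace hμ hh) (differentiableOn_laplace hμ hh) hz
      (x := (t : ℂ)) (by simp)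

open scoped ComplexConjugate

/-! ### The energy measure -/

instance : SigmaFinite energyMeasure := by
  unfold energyMeasure
  exact SigmaFinite.withDensity_of_ne_top (.of_forall fun _ => ENNReal.ofReal_ne_top)

instance : IsFiniteMeasure sphereMeasure := by unfold sphereMeasure; infer_instance

instance : Fact ((2 : ℝ≥0∞) ≠ ⊤) := ⟨by simp⟩

theorem ae_energyMeasure_pos : ∀ᵐ E ∂energyMeasure, 0 < E :=
  (withDensity_absolutelyContinuous _ _).ae_le (ae_restrict_mem measurableSet_Ioi)

theorem integral_energyMeasure (g : ℝ → ℂ) :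
    ∫ E, g E ∂energyMeasure = ∫ E in Ioi (0 : ℝ), (E : ℂ) * g E := by
  rw [energyMeasure, integral_withDensity_eq_integral_toReal_smul (by fun_prop)
    (.of_forall fun _ => ENNReal.ofReal_lt_top)]
  refine setIntegral_congr_fun measurableSet_Ioi fun E hE => ?_
  simp [ENNReal.toReal_ofReal (le_of_lt hE)]

theorem integrable_energyMeasure_of_integrable {g : ℝ → ℝ}
    (hg : Integrable fun E => E * g E) : Integrable g energyMeasure := by
  rw [energyMeasure, integrable_withDensity_iff_integrable_smul' (by fun_prop)
    (.of_forall fun _ => ENNReal.ofReal_lt_top)]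
  refine hg.integrableOn.congr_fun (fun E hE => ?_) measurableSet_Ioi
  simp [ENNReal.toReal_ofReal (le_of_lt hE)]

/-! ### The Fourier transform of a test function -/

/-- A smooth real function of compact support as a complex Schwartz function. -/
def toSchwartz {f : ℝ → ℝ} (hf : ContDiff ℝ ∞ f) (hc : HasCompactSupport f) : SchwartzMap ℝ ℂ :=
  (hc.comp_left (g := fun x : ℝ => (x : ℂ)) rfl).toSchwartzMap (Complex.ofRealCLM.contDiff.comp hf)

theorem toSchwartz_apply {f : ℝ → ℝ} (hf : ContDiff ℝ ∞ f) (hc : HasCompactSupport f) (x : ℝ) :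
    toSchwartz hf hc x = f x := rfl

/-- Mathlib's kernel is `exp(-2πi xξ)`, whence the rescaled and reflected argument. This opens the
way to Schwartz decay and Plancherel. -/
theorem fourier_eq_schwartz {f : ℝ → ℝ} (hf : ContDiff ℝ ∞ f) (hc : HasCompactSupport f) (E : ℝ) :
    fourier f E = ((Real.sqrt (2 * Real.pi))⁻¹ : ℝ) *
      FourierTransform.fourier (toSchwartz hf hc) (-(2 * Real.pi)⁻¹ * E) := by
  rw [fourier, SchwartzMap.fourier_coe, Real.fourier_eq']
  congr 2
  ext u
  rw [toSchwartz_apply, smul_eq_mul, mul_comm]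
  congr 2
  have : (Real.pi : ℂ) ≠ 0 := by exact_mod_cast Real.pi_ne_zero
  simp
  field_simp

theorem fourier_neg (f : ℝ → ℝ) (E : ℝ) : fourier f (-E) = conj (fourier f E) := by
  rw [fourier, fourier, map_mul, Complex.conj_ofReal, ← integral_conj]
  congr 2
  ext u
  simp [← Complex.exp_conj]

theorem continuous_fourier {f : ℝ → ℝ} (hf : ContDiff ℝ ∞ f) (hc : HasCompactSupport f) :
    Continuous (fourier f) := by
  rw [funext (fourier_eq_schwartz hf hc)]
  exact continuous_const.mul ((SchwartzMap.continuous _).comp (by fun_prop))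

theorem memLp_fourier {f : ℝ → ℝ} (hf : ContDiff ℝ ∞ f) (hc : HasCompactSupport f) :
    MemLp (fourier f) 2 energyMeasure := by
  rw [memLp_two_iff_integrable_sq_norm (continuous_fourier hf hc).aestronglyMeasurable]
  apply integrable_energyMeasure_of_integrable
  have hpi : 0 < (2 * Real.pi)⁻¹ := by positivity
  set a := (2 * Real.pi)⁻¹
  set c := (Real.sqrt (2 * Real.pi))⁻¹
  set G : SchwartzMap ℝ ℂ := FourierTransform.fourier (toSchwartz hf hc)
  -- In `|E| |G|²`, decay bounds `|E| |G|` and the remaining factor `|G|` is integrable.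
  obtain ⟨C, hC⟩ := G.decay 1 0
  have hint : Integrable fun E => ‖G (-a * E)‖ := G.integrable.norm.comp_mul_left' (by simp [hpi.ne'])
  refine (hint.const_mul (c ^ 2 * (a⁻¹ * C))).mono' ?_ (.of_forall fun E => ?_)
  · exact (continuous_id.mul ((continuous_fourier hf hc).norm.pow 2)).aestronglyMeasurable
  · have h := hC.2 (-a * E)
    simp only [pow_one, norm_iteratedFDeriv_zero, norm_mul, norm_neg] at h
    rw [fourier_eq_schwartz hf hc, norm_mul, norm_mul, norm_pow, norm_mul, norm_norm,
      norm_norm, Complex.norm_real, mul_pow, Real.norm_eq_abs c, sq_abs]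
    have h2 : ‖E‖ * ‖G (-a * E)‖ ≤ a⁻¹ * C := by
      rw [← div_eq_inv_mul, le_div_iff₀ hpi]
      rw [Real.norm_of_nonneg hpi.le] at h
      linarith
    calc ‖E‖ * (c ^ 2 * ‖G (-a * E)‖ ^ 2)
        = c ^ 2 * (‖E‖ * ‖G (-a * E)‖) * ‖G (-a * E)‖ := by ring
      _ ≤ c ^ 2 * (a⁻¹ * C) * ‖G (-a * E)‖ := by gcongr

theorem fourier_comp_sub (f : ℝ → ℝ) (t E : ℝ) :
    fourier (fun u => f (u - t)) E = Complex.exp (Complex.I * E * t) * fourier f E := by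
  have h := integral_sub_right_eq_self (μ := volume) (fun u : ℝ => (f u : ℂ) *
    Complex.exp (Complex.I * E * u)) t
  rw [fourier, fourier, ← h, mul_left_comm (Complex.exp _), ← integral_const_mul (Complex.exp _)]
  congr 2
  ext u
  rw [mul_left_comm, ← Complex.exp_add]
  push_cast
  ring_nf

/-- Translating a test function translates its support. -/
theorem IsTestOnLine.comp_sub {I : Set ℝ} {f : ℝ → ℝ} (hf : IsTestOnLine I f) (t : ℝ) :
    IsTestOnLine {u | u - t ∈ I} fun u => f (u - t) := by
  obtain ⟨h1, h2, h3⟩ := hf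
  refine ⟨h1.comp (by fun_prop), h2.comp_homeomorph (Homeomorph.subRight t), ?_⟩
  have := tsupport_comp_eq_preimage f (Homeomorph.subRight t)
  exact this.subset.trans (preimage_mono h3)

/-! ### Totality and locality for the current on the line. -/

/-- A narrow bump has a non-vanishing Fourier transform at low energies. -/
theorem fourier_ne_zero_of_narrow {f : ℝ → ℝ} {u₀ r E : ℝ} (hf : Continuous f)
    (hc : HasCompactSupport f) (hnn : 0 ≤ f) (hpos : f u₀ ≠ 0)
    (hs : ∀ u, f u ≠ 0 → |u - u₀| < r) (hr : |E| * r < Real.pi / 2) : fourier f E ≠ 0 := by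
  intro h0
  have h1 : ∫ u : ℝ, (f u : ℂ) * Complex.exp (Complex.I * E * u) = 0 := by
    rcases mul_eq_zero.1 h0 with h | h
    · have : Real.sqrt (2 * Real.pi) ≠ 0 := by positivity
      exact absurd (Complex.ofReal_eq_zero.1 h) (inv_ne_zero this)
    · exact h
  -- Removing the phase `exp(iEu₀)` and taking real parts leaves a cosine that is nonnegative on the
  -- support of `f`.
  have h2 : ∫ u : ℝ, f u * Real.cos (E * (u - u₀)) = 0 := by
    have h3 : ∫ u : ℝ, Complex.exp (-(Complex.I * E * u₀)) *
        ((f u : ℂ) * Complex.exp (Complex.I * E * u)) = 0 := by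
      rw [integral_const_mul, h1, mul_zero]
    have h4 := integral_re ((integrable_fourier hf hc E).const_mul
      (Complex.exp (-(Complex.I * E * u₀))))
    rw [h3] at h4
    simp only [map_zero] at h4
    rw [← h4]
    congr 1
    ext u
    rw [mul_left_comm, ← Complex.exp_add]
    have : -(Complex.I * E * u₀) + Complex.I * E * u = ((E * (u - u₀) : ℝ) : ℂ) * Complex.I := by
      push_cast; ring
    rw [this]
    exact ((Complex.re_ofReal_mul _ _).trans (by rw [Complex.exp_ofReal_mul_I_re])).symm
  refine (Continuous.integral_pos_of_hasCompactSupport_nonneg_nonzero (μ := volume)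
    (f := fun u => f u * Real.cos (E * (u - u₀))) (by fun_prop) hc.mul_right ?_
    (x := u₀) (by simpa using hpos)).ne' h2
  intro u
  by_cases hu : f u = 0
  · simp [hu]
  · have := hs u hu
    have h5 : |E * (u - u₀)| ≤ Real.pi / 2 := by
      rw [abs_mul]
      exact (mul_le_mul_of_nonneg_left this.le (abs_nonneg _)).trans hr.le
    exact mul_nonneg (hnn u) (Real.cos_nonneg_of_mem_Icc (abs_le.1 h5))

/-- The one-particle Reeh–Schlieder property: test functions supported in a non-empty open set are
total. -/
theorem eq_zero_of_orthogonal_test {J : Set ℝ} (hJ : IsOpen J) (hne : J.Nonempty)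
    {y : CurrentSpace}
    (hy : ∀ f, IsTestOnLine J f → ∫ E, conj (y E) * fourier f E ∂energyMeasure = 0) : y = 0 := by
  obtain ⟨u₀, hu₀⟩ := hne
  obtain ⟨δ, hδ, hball⟩ := Metric.isOpen_iff.1 hJ u₀ hu₀
  -- Radii below `δ/2` keep the bumps inside `J` under translations by `|t| < δ/2`; radii tending to
  -- `0` make some transform nonzero at any given energy.
  let b : ℕ → ContDiffBump u₀ := fun j =>
    ⟨δ / (j + 3) / 2, δ / (j + 3), by positivity, half_lt_self (by positivity)⟩
  have hb : ∀ j, ∀ᵐ E ∂energyMeasure, conj (y E) * fourier (b j) E = 0 := by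
    intro j
    have hint : Integrable (fun E => conj (y E) * fourier (b j) E) energyMeasure :=
      (Lp.memLp y).star.integrable_mul (memLp_fourier (b j).contDiff (b j).hasCompactSupport)
    refine ae_eq_zero_of_fourier_eq_zero_near (ae_energyMeasure_pos.mono fun E hE => hE.le) hint
      (half_pos hδ) fun t ht => ?_
    have ht1 : IsTestOnLine J fun u => b j (u - t) := by
      obtain ⟨h1, h2, h3⟩ := IsTestOnLine.comp_sub (f := b j)
        (I := Metric.closedBall u₀ (δ / (j + 3)))
        ⟨(b j).contDiff, (b j).hasCompactSupport, (b j).tsupport_eq.subset⟩ t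
      refine ⟨h1, h2, h3.trans fun u hu => hball ?_⟩
      have hu' : |u - t - u₀| ≤ δ / (j + 3) := by
        simpa [Real.dist_eq, sub_right_comm, sub_add_eq_sub_sub] using hu
      have hj : δ / (j + 3) < δ / 2 := by gcongr; linarith [(Nat.cast_nonneg j : (0 : ℝ) ≤ j)]
      rw [Metric.mem_ball, Real.dist_eq]
      calc |u - u₀| = |(u - t - u₀) + t| := by ring_nf
        _ ≤ |u - t - u₀| + |t| := abs_add_le _ _
        _ < δ := by linarith
    -- Translation by `t` multiplies the transform by `exp(iEt)`, so orthogonality to the translates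
    -- is exactly vanishing of a Fourier integral near `0`.
    rw [← hy _ ht1]
    congr 1
    ext E
    rw [fourier_comp_sub]
    ring
  apply Lp.ext
  filter_upwards [ae_all_iff.2 hb, Lp.coeFn_zero ℂ 2 energyMeasure] with E hE h0
  rw [h0]
  obtain ⟨j, hj⟩ := exists_nat_gt (|E| * δ / (Real.pi / 2))
  have hnz : fourier (b j) E ≠ 0 := by
    refine fourier_ne_zero_of_narrow (u₀ := u₀) (r := δ / (j + 3)) (b j).continuous
      (b j).hasCompactSupport (fun u => (b j).nonneg) ?_ (fun u hu => ?_) ?_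
    · exact ((b j).pos_of_mem_ball (Metric.mem_ball_self (b j).rOut_pos)).ne'
    · have : u ∈ Function.support (b j) := hu
      rw [(b j).support_eq] at this
      simpa [Real.dist_eq] using this
    · rw [div_lt_iff₀ (by positivity)] at hj
      rw [← mul_div_assoc, div_lt_iff₀ (by positivity)]
      nlinarith [Real.pi_pos]
  simpa [hnz] using hE j

/-- Test functions with disjoint supports are symplectically orthogonal. -/
theorem im_integral_fourier_eq_zero {I J : Set ℝ} {f g : ℝ → ℝ} (hf : IsTestOnLine I f)
    (hg : IsTestOnLine J g) (hIJ : Disjoint I J) :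
    (∫ E, conj (fourier f E) * fourier g E ∂energyMeasure).im = 0 := by
  obtain ⟨hf1, hf2, hf3⟩ := hf
  obtain ⟨hg1, hg2, hg3⟩ := hg
  set F := toSchwartz hf1 hf2
  set G := toSchwartz hg1 hg2
  -- The weight `E` of the measure becomes a derivative of `g`; by Plancherel the integral over the
  -- whole line is a multiple of `∫ f g'`.
  set G' := SchwartzMap.derivCLM ℂ ℂ G
  have hG' : ∀ x : ℝ, FourierTransform.fourier G' x =
      (2 * Real.pi * Complex.I * x) * FourierTransform.fourier G x := by
    intro x
    have h := congrFun (Real.fourier_deriv G.integrable G.differentiable G'.integrable) x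
    exact h
  set K : ℝ → ℂ := fun x => conj (FourierTransform.fourier F x) * FourierTransform.fourier G' x
  have hKint : Integrable K :=
    ((FourierTransform.fourier F : SchwartzMap ℝ ℂ).memLp 2).star.integrable_mul
      ((FourierTransform.fourier G' : SchwartzMap ℝ ℂ).memLp 2)
  have hK0 : ∫ x, K x = 0 := by
    have h := SchwartzMap.integral_inner_fourier_fourier F G'
    simp only [RCLike.inner_apply'] at h
    refine h.trans ?_
    rw [← integral_zero ℝ ℂ (μ := volume)]
    congr 1
    ext x
    by_cases hx : f x = 0
    · simp [F, toSchwartz_apply, hx]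
    · have hx1 : x ∉ tsupport g := fun h =>
        disjoint_left.1 hIJ (hf3 (subset_tsupport _ hx)) (hg3 h)
      have hx2 : x ∉ tsupport (G : ℝ → ℂ) := fun h =>
        hx1 (tsupport_comp_subset (g := fun x : ℝ => (x : ℂ)) rfl g h)
      have hx3 : deriv G x = 0 := by
        by_contra h
        exact hx2 (support_deriv_subset h)
      simp [G', SchwartzMap.derivCLM_apply, hx3]
  set k : ℝ → ℂ := fun E => (E : ℂ) * (conj (fourier f E) * fourier g E)
  set a : ℝ := -(2 * Real.pi)⁻¹
  have ha : a ≠ 0 := by simp [a, Real.pi_ne_zero]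
  obtain ⟨d, hd⟩ : ∃ d : ℂ, ∀ E, k E = d * K (a * E) := by
    -- The factor `I` cancels `2πi a = -i` produced by the derivative.
    refine ⟨((Real.sqrt (2 * Real.pi))⁻¹ : ℝ) ^ 2 * Complex.I, fun E => ?_⟩
    simp only [k, K]
    rw [fourier_eq_schwartz hf1 hf2, fourier_eq_schwartz hg1 hg2, hG', map_mul,
      Complex.conj_ofReal]
    have : (Real.pi : ℂ) ≠ 0 := by exact_mod_cast Real.pi_ne_zero
    simp only [a]
    push_cast
    field_simp
    rw [Complex.I_sq]
    ring
  have hkint : Integrable k := by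
    rw [funext hd]
    exact (hKint.comp_mul_left' ha).const_mul d
  have hk0 : ∫ E, k E = 0 := by
    simp only [hd]
    rw [integral_const_mul, Measure.integral_comp_mul_left K a, hK0]
    simp
  -- Since `f` and `g` are real, the whole-line integral is the half-line one minus its conjugate,
  -- that is `2i` times the wanted imaginary part.
  have hneg : ∀ E, k (-E) = -conj (k E) := by
    intro E
    simp only [k, fourier_neg, map_mul, Complex.conj_conj, Complex.conj_ofReal]
    push_cast
    ring
  have hN : ∫ E in Iic (0 : ℝ), k E = -conj (∫ E in Ioi (0 : ℝ), k E) := by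
    have h := integral_comp_neg_Ioi (0 : ℝ) k
    rw [neg_zero] at h
    rw [← h, ← integral_conj, ← integral_neg]
    simp only [hneg]
  rw [integral_energyMeasure]
  have hsum := intervalIntegral.integral_Iic_add_Ioi (b := (0 : ℝ)) hkint.integrableOn
    hkint.integrableOn
  rw [hk0, hN] at hsum
  have him := congrArg Complex.im hsum
  simp at him
  change (∫ E in Ioi (0 : ℝ), k E).im = 0
  linarith

/-- The vector of the one-particle space defined by a test function. -/
def testVector {I : Set ℝ} {f : ℝ → ℝ} (hf : IsTestOnLine I f) : CurrentSpace :=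
  (memLp_fourier hf.1 hf.2.1).toLp

theorem testVector_coe {I : Set ℝ} {f : ℝ → ℝ} (hf : IsTestOnLine I f) :
    testVector hf =ᵐ[energyMeasure] fourier f := MemLp.coeFn_toLp _

theorem testVector_mem {I : Set ℝ} {f : ℝ → ℝ} (hf : IsTestOnLine I f) :
    testVector hf ∈ currentTestSpace I := ⟨f, hf, testVector_coe hf⟩

theorem eq_zero_of_inner_eq_zero {J : Set ℝ} (hJ : IsOpen J) (hne : J.Nonempty)
    {y : CurrentSpace} (hy : ∀ x ∈ currentTestSpace J, inner ℂ x y = 0) : y = 0 := by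
  refine eq_zero_of_orthogonal_test hJ hne fun f hf => ?_
  have h := hy _ (testVector_mem hf)
  rw [← inner_conj_symm, map_eq_zero, L2.inner_def] at h
  rw [← h]
  refine integral_congr_ae ?_
  filter_upwards [testVector_coe hf] with E hE
  rw [hE, RCLike.inner_apply']

theorem real_inner_eq_re_inner {α : Type*} [MeasurableSpace α] {μ : Measure α}
    (f g : Lp ℂ 2 μ) : inner ℝ f g = (inner ℂ f g : ℂ).re := by
  rw [L2.inner_def, L2.inner_def]
  exact integral_re (L2.integrable_inner f g)

theorem im_inner_eq_zero {I J : Set ℝ} (hIJ : Disjoint J I) {x z : CurrentSpace}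
    (hx : x ∈ currentTestSpace J) (hz : z ∈ (currentTestSpace I).topologicalClosure) :
    (inner ℂ x z : ℂ).im = 0 := by
  have hclosed : IsClosed {z : CurrentSpace | (inner ℂ x z : ℂ).im = 0} :=
    isClosed_eq (Complex.continuous_im.comp (continuous_const.inner continuous_id))
      continuous_const
  refine closure_minimal (fun z hz => ?_) hclosed hz
  obtain ⟨f, hf, hxf⟩ := hx
  obtain ⟨g, hg, hzg⟩ := hz
  rw [mem_ofPred_eq, L2.inner_def, ← im_integral_fourier_eq_zero hf hg hIJ]
  congr 1
  refine integral_congr_ae ?_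
  filter_upwards [hxf, hzg] with E h1 h2
  rw [h1, h2, RCLike.inner_apply']

/-- If `x = iy`, locality for `x` kills the real part of `⟨z, y⟩` and locality for `y` the imaginary
part, for every test vector `z` of `J`; these are total. -/
theorem isSeparating_of_disjoint {I J : Set ℝ} (hJ : IsOpen J) (hne : J.Nonempty)
    (hIJ : Disjoint J I) : IsSeparating (currentTestSpace I).topologicalClosure := by
  intro x hx y hy hxy
  have hy0 : y = 0 := by
    refine eq_zero_of_inner_eq_zero hJ hne fun z hz => ?_
    have h1 := im_inner_eq_zero hIJ hz hx
    have h2 := im_inner_eq_zero hIJ hz hy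
    rw [hxy, inner_smul_right] at h1
    exact Complex.ext (by simpa using h1) h2
  rw [hxy, hy0, smul_zero]

open Filter Topology

/-! ### Fibres of vectors over the sphere -/

instance : SFinite momentumMeasure := by unfold momentumMeasure; infer_instance

theorem ae_slice {P : ℝ × S2 → Prop} (h : ∀ᵐ p ∂momentumMeasure, P p) :
    ∀ᵐ n ∂sphereMeasure, ∀ᵐ E ∂energyMeasure, P (E, n) :=
  Measure.ae_ae_of_ae_prod (p := fun q : S2 × ℝ => P q.swap)
    (Measure.measurePreserving_swap.quasiMeasurePreserving.ae h)

theorem component_coe (ξ : ScriSpace) :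
    ∀ᵐ n ∂sphereMeasure, component ξ n =ᵐ[energyMeasure] fun E => ξ (E, n) := by
  have h := (memLp_two_iff_integrable_sq_norm (Lp.aestronglyMeasurable ξ)).1 (Lp.memLp ξ)
  filter_upwards [Integrable.prod_left_ae (μ := energyMeasure) (ν := sphereMeasure) h] with n hn
  have hm : AEStronglyMeasurable (fun E => ξ (E, n)) energyMeasure :=
    ((Lp.stronglyMeasurable ξ).comp_measurable measurable_prodMk_right).aestronglyMeasurable
  have hL : MemLp (fun E => ξ (E, n)) 2 energyMeasure :=
    (memLp_two_iff_integrable_sq_norm hm).2 hn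
  rw [component, dif_pos hL]
  exact hL.coeFn_toLp

/-- If the slices of a vector are represented by given one-particle vectors, these are its
components. -/
theorem component_eq {ξ : ScriSpace} {x : S2 → CurrentSpace} {φ : ℝ × S2 → ℂ}
    (h : ξ =ᵐ[momentumMeasure] φ)
    (hx : ∀ᵐ n ∂sphereMeasure, x n =ᵐ[energyMeasure] fun E => φ (E, n)) :
    ∀ᵐ n ∂sphereMeasure, component ξ n = x n := by
  filter_upwards [component_coe ξ, ae_slice h, hx] with n h1 h2 h3
  apply Lp.ext
  filter_upwards [h1, h2, h3] with E h1 h2 h3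
  rw [h1, h2, h3]

theorem component_sub (ξ η : ScriSpace) :
    ∀ᵐ n ∂sphereMeasure, component (ξ - η) n = component ξ n - component η n := by
  refine component_eq (Lp.coeFn_sub ξ η) ?_
  filter_upwards [component_coe ξ, component_coe η] with n h1 h2
  filter_upwards [h1, h2, Lp.coeFn_sub (component ξ n) (component η n)] with E h1 h2 h3
  rw [h3, Pi.sub_apply, Pi.sub_apply, h1, h2]

theorem component_smul (c : ℂ) (ξ : ScriSpace) :
    ∀ᵐ n ∂sphereMeasure, component (c • ξ) n = c • component ξ n := by
  refine component_eq (Lp.coeFn_smul c ξ) ?_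
  filter_upwards [component_coe ξ] with n h1
  filter_upwards [h1, Lp.coeFn_smul c (component ξ n)] with E h1 h3
  rw [h3, Pi.smul_apply, Pi.smul_apply, h1]

theorem integral_inner_slice (ξ η : ScriSpace) : ∀ᵐ n ∂sphereMeasure,
    ∫ E, (inner ℝ (ξ (E, n)) (η (E, n)) : ℝ) ∂energyMeasure =
      inner ℝ (component ξ n) (component η n) := by
  filter_upwards [component_coe ξ, component_coe η] with n h1 h2
  rw [L2.inner_def]
  refine integral_congr_ae ?_
  filter_upwards [h1, h2] with E h1 h2
  rw [h1, h2]

theorem integrable_inner_component (ξ η : ScriSpace) :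
    Integrable (fun n => (inner ℝ (component ξ n) (component η n) : ℝ)) sphereMeasure :=
  (Integrable.integral_prod_right (μ := energyMeasure) (ν := sphereMeasure)
    (L2.integrable_inner (𝕜 := ℝ) ξ η)).congr (integral_inner_slice ξ η)

theorem inner_eq_integral_component (ξ η : ScriSpace) :
    (inner ℝ ξ η : ℝ) = ∫ n, (inner ℝ (component ξ n) (component η n) : ℝ) ∂sphereMeasure := by
  rw [L2.inner_def]
  refine (integral_prod_symm (μ := energyMeasure) (ν := sphereMeasure) _
    (L2.integrable_inner (𝕜 := ℝ) ξ η)).trans ?_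
  exact integral_congr_ae (integral_inner_slice ξ η)

theorem integrable_norm_sq_component (ξ : ScriSpace) :
    Integrable (fun n => ‖component ξ n‖ ^ 2) sphereMeasure := by
  simpa only [real_inner_self_eq_norm_sq] using integrable_inner_component ξ ξ

theorem norm_sq_eq_integral_component (ξ : ScriSpace) :
    ‖ξ‖ ^ 2 = ∫ n, ‖component ξ n‖ ^ 2 ∂sphereMeasure := by
  simpa only [real_inner_self_eq_norm_sq] using inner_eq_integral_component ξ ξ

theorem eq_zero_of_component_eq_zero {ξ : ScriSpace}
    (h : ∀ᵐ n ∂sphereMeasure, component ξ n = 0) : ξ = 0 := by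
  have h1 : ‖ξ‖ ^ 2 = 0 := by
    rw [norm_sq_eq_integral_component, integral_eq_zero_of_ae]
    filter_upwards [h] with n hn
    simp [hn]
  simpa using h1

/-- Membership of the components in closed fibres passes to the closure. -/
theorem component_mem_of_mem_closure {S : Set ScriSpace} {K : S2 → Set CurrentSpace}
    (hK : ∀ n, IsClosed (K n)) (hS : ∀ ξ ∈ S, ∀ᵐ n ∂sphereMeasure, component ξ n ∈ K n)
    {ξ : ScriSpace} (hξ : ξ ∈ closure S) : ∀ᵐ n ∂sphereMeasure, component ξ n ∈ K n := by
  obtain ⟨x, hxS, hx⟩ := mem_closure_iff_seq_limit.1 hξ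
  -- The integral of this function is `‖x m - ξ‖²`, so it tends to zero in L¹, hence in measure,
  -- hence almost everywhere along a subsequence.
  have hm : TendstoInMeasure sphereMeasure (fun m n => ‖component (x m - ξ) n‖ ^ 2) atTop
      fun _ => (0 : ℝ) := by
    refine tendstoInMeasure_of_tendsto_eLpNorm (p := 1) one_ne_zero
      (fun m => (integrable_norm_sq_component _).1) aestronglyMeasurable_const ?_
    have h1 : ∀ m, eLpNorm ((fun n => ‖component (x m - ξ) n‖ ^ 2) - fun _ => (0 : ℝ)) 1
        sphereMeasure = ENNReal.ofReal (‖x m - ξ‖ ^ 2) := by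
      intro m
      rw [norm_sq_eq_integral_component, eLpNorm_one_eq_lintegral_enorm,
        ofReal_integral_eq_lintegral_ofReal (integrable_norm_sq_component _)
          (.of_forall fun n => by positivity)]
      refine lintegral_congr fun n => ?_
      rw [Pi.sub_apply, sub_zero, Real.enorm_of_nonneg (by positivity)]
    simp only [h1]
    have h2 : Tendsto (fun m => ‖x m - ξ‖ ^ 2) atTop (𝓝 0) := by
      simpa using (tendsto_iff_norm_sub_tendsto_zero.1 hx).pow 2
    simpa using ENNReal.tendsto_ofReal h2
  obtain ⟨ns, -, hns⟩ := hm.exists_seq_tendsto_ae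
  filter_upwards [hns, ae_all_iff.2 fun m => component_sub (x m) ξ,
    ae_all_iff.2 fun m => hS _ (hxS m)] with n h1 h2 h3
  have h4 : Tendsto (fun i => component (x (ns i)) n) atTop (𝓝 (component ξ n)) := by
    rw [tendsto_iff_norm_sub_tendsto_zero]
    have h5 := h1.sqrt
    simpa [h2] using h5
  exact (hK n).mem_of_tendsto h4 (.of_forall fun i => h3 _)

/-! ### Product vectors -/

/-- Smooth `g` will give test vectors, indicator functions the fundamental sections, so only bounded
measurable `g` is asked for. -/
theorem memLp_tensor (x : CurrentSpace) {g : S2 → ℝ} (hg : Measurable g) {C : ℝ}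
    (hC : ∀ n, |g n| ≤ C) : MemLp (fun p : ℝ × S2 => (g p.2 : ℂ) * x p.1) 2 momentumMeasure := by
  have h : MemLp (fun p : ℝ × S2 => x p.1) 2 momentumMeasure :=
    (Lp.memLp x).comp_fst sphereMeasure
  refine h.of_le_mul (c := C) ?_ (.of_forall fun p => ?_)
  · exact (Complex.measurable_ofReal.comp (hg.comp measurable_snd)).aestronglyMeasurable.mul h.1
  · rw [norm_mul, Complex.norm_real]
    exact mul_le_mul_of_nonneg_right (hC _) (norm_nonneg _)

theorem component_tensor (x : CurrentSpace) {g : S2 → ℝ} (hg : Measurable g) {C : ℝ}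
    (hC : ∀ n, |g n| ≤ C) :
    ∀ᵐ n ∂sphereMeasure, component (memLp_tensor x hg hC).toLp n = g n • x := by
  refine component_eq (memLp_tensor x hg hC).coeFn_toLp (.of_forall fun n => ?_)
  filter_upwards [Lp.coeFn_smul (g n) x] with E h
  rw [h, Pi.smul_apply, Complex.real_smul]

/-! ### Local subspaces of open regions with interval slices -/

/-- The intersection of a region with a light ray. -/
def slice (O : Set ScriPlus) (n : S2) : Set ℝ := {u | (u, n) ∈ O}

/-- The one-particle subspace of the slice of a region. -/
def fibre (O : Set ScriPlus) (n : S2) : Submodule ℝ CurrentSpace :=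
  (currentTestSpace (slice O n)).topologicalClosure

theorem isOpen_slice {O : Set ScriPlus} (hO : IsOpen O) (n : S2) : IsOpen (slice O n) :=
  hO.preimage (by fun_prop : Continuous fun u : ℝ => (u, n))

theorem isClosed_fibre (O : Set ScriPlus) (n : S2) : IsClosed (fibre O n : Set CurrentSpace) :=
  Submodule.isClosed_topologicalClosure _

theorem IsTestOnScri.slice {O : Set ScriPlus} {ψ : ScriPlus → ℝ} (h : IsTestOnScri O ψ) (n : S2) :
    IsTestOnLine (slice O n) fun u => ψ (u, n) := by
  obtain ⟨h1, h2, h3⟩ := h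
  refine ⟨?_, slice_hasCompactSupport h2 n, ?_⟩
  · rw [← contMDiff_iff_contDiff]
    exact h1.comp (contMDiff_id.prodMk contMDiff_const)
  · exact (tsupport_comp_subset_preimage ψ (f := fun u : ℝ => (u, n)) (by fun_prop)).trans
      (preimage_mono h3)

/-- The easy half of the fibre criterion: slices of test functions are test functions, and the
fibres are closed. -/
theorem component_mem_fibre {O : Set ScriPlus} {ξ : ScriSpace} (hξ : ξ ∈ scriSubspace O) :
    ∀ᵐ n ∂sphereMeasure, component ξ n ∈ fibre O n := by
  refine component_mem_of_mem_closure (S := scriTestSpace O) (K := fun n => (fibre O n : Set _))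
    (isClosed_fibre O) ?_ hξ
  rintro ξ ⟨ψ, hψ, hξ⟩
  filter_upwards [component_eq hξ (.of_forall fun n => testVector_coe (hψ.slice n))] with n hn
  rw [hn]
  exact Submodule.le_topologicalClosure _ (testVector_mem (hψ.slice n))

/-- The directions whose light ray contains the interval `[a, b]` inside `O`. -/
def directions (O : Set ScriPlus) (a b : ℝ) : Set S2 := {n | Icc a b ⊆ slice O n}

/-- The tube lemma for the compact interval `[a, b]`. -/
theorem isOpen_directions {O : Set ScriPlus} (hO : IsOpen O) (a b : ℝ) :
    IsOpen (directions O a b) := by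
  rw [isOpen_iff_eventually]
  intro n hn
  refine isCompact_Icc.eventually_forall_of_forall_eventually fun u hu => ?_
  have : Prod.swap ⁻¹' O ∈ 𝓝 (n, u) := (hO.preimage continuous_swap).mem_nhds (hn hu)
  exact this

/-- Rational end points leave only countably many intervals, so exceptional null sets can be united.
Order-connectedness fills the gaps of `K`. -/
theorem exists_rat_interval {K S : Set ℝ} (hK : IsCompact K) (hS : IsOpen S)
    (hconn : S.OrdConnected) (hKS : K ⊆ S) (hne : K.Nonempty) :
    ∃ a b : ℚ, K ⊆ Ioo (a : ℝ) b ∧ Icc (a : ℝ) b ⊆ S := by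
  obtain ⟨l, hl, hl'⟩ := hK.exists_isLeast hne
  obtain ⟨r, hr, hr'⟩ := hK.exists_isGreatest hne
  obtain ⟨l', hl1, hl2⟩ := mem_nhdsLT_iff_exists_Ioo_subset.1
    (nhdsWithin_le_nhds (s := Iio l) (hS.mem_nhds (hKS hl)))
  obtain ⟨r', hr1, hr2⟩ := mem_nhdsGT_iff_exists_Ioo_subset.1
    (nhdsWithin_le_nhds (s := Ioi r) (hS.mem_nhds (hKS hr)))
  obtain ⟨a, ha1, ha2⟩ := exists_rat_btwn (mem_Iio.1 hl1)
  obtain ⟨b, hb1, hb2⟩ := exists_rat_btwn (mem_Ioi.1 hr1)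
  exact ⟨a, b, fun x hx => ⟨ha2.trans_le (hl' hx), (hr' hx).trans_lt hb1⟩,
    hconn.out (hl2 ⟨ha1, ha2⟩) (hr2 ⟨hb1, hb2⟩)⟩

theorem currentTestSpace_mono {I J : Set ℝ} (h : I ⊆ J) :
    currentTestSpace I ≤ currentTestSpace J := by
  rintro ξ ⟨f, ⟨h1, h2, h3⟩, hξ⟩
  exact ⟨f, ⟨h1, h2, h3.trans h⟩, hξ⟩

/-- A dense sequence of test vectors of an interval. -/
def testSeq (a b : ℝ) (k : ℕ) : CurrentSpace :=
  (TopologicalSpace.denseSeq (currentTestSpace (Ioo a b)) k : CurrentSpace)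

theorem testSeq_mem (a b : ℝ) (k : ℕ) : testSeq a b k ∈ currentTestSpace (Ioo a b) :=
  (TopologicalSpace.denseSeq (currentTestSpace (Ioo a b)) k).2

theorem currentTestSpace_subset_closure_testSeq (a b : ℝ) :
    (currentTestSpace (Ioo a b) : Set CurrentSpace) ⊆ closure (range (testSeq a b)) := by
  intro x hx
  have h := (TopologicalSpace.denseRange_denseSeq (currentTestSpace (Ioo a b))) ⟨x, hx⟩
  have h2 := image_closure_subset_closure_image continuous_subtype_val (mem_image_of_mem _ h)
  rwa [← range_comp] at h2

theorem currentTestSpace_empty : currentTestSpace ∅ = ⊥ := by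
  rw [Submodule.eq_bot_iff]
  rintro ξ ⟨f, ⟨-, -, h3⟩, hξ⟩
  have hf : f = 0 := tsupport_eq_empty_iff.1 (subset_empty_iff.1 h3)
  apply Lp.ext
  filter_upwards [hξ, Lp.coeFn_zero ℂ 2 energyMeasure] with E h4 h5
  rw [h4, h5, hf]
  exact fourier_zero E

/-- The test space of an interval slice is exhausted by those of rational subintervals. -/
theorem mem_testSpace_rat {O : Set ScriPlus} (hO : IsOpen O) {n : S2}
    (hconn : (slice O n).OrdConnected) {x : CurrentSpace}
    (hx : x ∈ currentTestSpace (slice O n)) :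
    x = 0 ∨ ∃ a b : ℚ, n ∈ directions O a b ∧ x ∈ currentTestSpace (Ioo (a : ℝ) b) := by
  obtain ⟨f, ⟨h1, h2, h3⟩, hξ⟩ := hx
  rcases (tsupport f).eq_empty_or_nonempty with he | hne
  · left
    have h : x ∈ currentTestSpace ∅ := ⟨f, ⟨h1, h2, he.subset⟩, hξ⟩
    simpa [currentTestSpace_empty] using h
  · right
    obtain ⟨a, b, ha, hb⟩ := exists_rat_interval h2 (isOpen_slice hO n) hconn h3 hne
    exact ⟨a, b, hb, f, ⟨h1, h2, ha⟩, hξ⟩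

/-- Tests an inclusion of the whole fibre on countably many vectors that do not depend on `n`. -/
theorem fibre_le_of_testSeq_mem {O : Set ScriPlus} (hO : IsOpen O) {n : S2}
    (hconn : (slice O n).OrdConnected) {K : Submodule ℝ CurrentSpace}
    (hK : IsClosed (K : Set CurrentSpace))
    (h : ∀ (a b : ℚ) (k : ℕ), n ∈ directions O a b → testSeq a b k ∈ K) : fibre O n ≤ K := by
  refine Submodule.topologicalClosure_minimal _ (fun x hx => ?_) hK
  rcases mem_testSpace_rat hO hconn hx with rfl | ⟨a, b, hn, hx⟩
  · exact K.zero_mem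
  · exact closure_minimal (range_subset_iff.2 fun k => h a b k hn) hK
      (currentTestSpace_subset_closure_testSeq _ _ hx)

theorem testSeq_mem_fibre {O : Set ScriPlus} {n : S2} {a b : ℝ} (hn : n ∈ directions O a b)
    (k : ℕ) : testSeq a b k ∈ fibre O n :=
  Submodule.le_topologicalClosure _
    (currentTestSpace_mono (Ioo_subset_Icc_self.trans hn) (testSeq_mem a b k))

theorem exists_abs_le_of_continuous {g : S2 → ℝ} (hg : Continuous g) : ∃ C, ∀ n, |g n| ≤ C := by
  obtain ⟨C, hC⟩ := isCompact_univ.exists_bound_of_continuousOn hg.continuousOn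
  exact ⟨C, fun n => hC n (mem_univ n)⟩

/-- Products of test functions are test functions. -/
theorem tensor_mem_scriTestSpace {O : Set ScriPlus} {a b : ℝ} {x : CurrentSpace}
    (hx : x ∈ currentTestSpace (Ioo a b)) {g : S2 → ℝ} (hg : ContMDiff (𝓡 2) 𝓘(ℝ, ℝ) ∞ g)
    (hgs : tsupport g ⊆ directions O a b) {C : ℝ} (hC : ∀ n, |g n| ≤ C) :
    (memLp_tensor x hg.continuous.measurable hC).toLp ∈ scriTestSpace O := by
  obtain ⟨f, ⟨h1, h2, h3⟩, hξ⟩ := hx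
  have hsupp : tsupport (fun p : ScriPlus => f p.1 * g p.2) ⊆ tsupport f ×ˢ tsupport g := by
    refine closure_minimal (fun p hp => ?_) ((isClosed_tsupport f).prod (isClosed_tsupport g))
    exact ⟨subset_tsupport _ (left_ne_zero_of_mul hp), subset_tsupport _ (right_ne_zero_of_mul hp)⟩
  refine ⟨fun p => f p.1 * g p.2, ⟨?_, ?_, ?_⟩, ?_⟩
  · exact (h1.contMDiff.comp contMDiff_fst).mul (hg.comp contMDiff_snd)
  · exact (h2.isCompact.prod (isClosed_tsupport g).isCompact).of_isClosed_subset
      (isClosed_tsupport _) hsupp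
  · exact hsupp.trans fun p hp => hgs hp.2 (Ioo_subset_Icc_self (h3 hp.1))
  · filter_upwards [(memLp_tensor x hg.continuous.measurable hC).coeFn_toLp,
      (Measure.quasiMeasurePreserving_fst (μ := energyMeasure) (ν := sphereMeasure)).ae hξ]
      with p hp h4
    rw [hp, h4, scriFourier]
    have : (fun u => f u * g p.2) = fun u => g p.2 * f u := funext fun u => mul_comm _ _
    simp only [this, fourier_smul, Complex.real_smul]

/-! ### The fibre criterion for membership in `H(O)`. -/

/-- A vector which is orthogonal to the test functions of a region has components orthogonal to the
fibres. -/
theorem component_mem_orthogonal {O : Set ScriPlus} (hO : IsOpen O)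
    (hconn : ∀ n, (slice O n).OrdConnected) {ξ : ScriSpace}
    (h : ∀ η ∈ scriTestSpace O, (inner ℝ η ξ : ℝ) = 0) :
    ∀ᵐ n ∂sphereMeasure, ∀ x ∈ fibre O n, (inner ℝ (component ξ n) x : ℝ) = 0 := by
  have key : ∀ (a b : ℚ) (k : ℕ), ∀ᵐ n ∂sphereMeasure, n ∈ directions O a b →
      (inner ℝ (component ξ n) (testSeq a b k) : ℝ) = 0 := by
    intro a b k
    set x := testSeq a b k
    have hint : Integrable (fun n => (inner ℝ (component ξ n) x : ℝ)) sphereMeasure := by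
      have hC : ∀ n : S2, |(fun _ : S2 => (1 : ℝ)) n| ≤ 1 := by simp
      refine (integrable_inner_component ξ
        (memLp_tensor x measurable_const hC).toLp).congr ?_
      filter_upwards [component_tensor x measurable_const hC] with n hn
      rw [hn, one_smul]
    -- Fundamental lemma on the open set of directions: any smooth `g` supported there makes `g ⊗ x`
    -- a test vector of `O`.
    refine IsOpen.ae_eq_zero_of_integral_contMDiff_smul_eq_zero (𝓡 2)
      (isOpen_directions hO a b) (hint.locallyIntegrable.locallyIntegrableOn _)
      fun g hg _ hgs => ?_
    obtain ⟨C, hC⟩ := exists_abs_le_of_continuous hg.continuous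
    have h1 := h _ (tensor_mem_scriTestSpace (testSeq_mem a b k) hg hgs hC)
    rw [real_inner_comm, inner_eq_integral_component] at h1
    rw [← h1]
    refine integral_congr_ae ?_
    filter_upwards [component_tensor x hg.continuous.measurable hC] with n hn
    rw [hn, inner_smul_right, smul_eq_mul]
  filter_upwards [ae_all_iff.2 fun a => ae_all_iff.2 fun b => ae_all_iff.2 fun k => key a b k]
    with n hn x hx
  exact (fibre_le_of_testSeq_mem hO (hconn n)
    (K := LinearMap.ker (innerSL ℝ (component ξ n)).toLinearMap)
    (innerSL ℝ (component ξ n)).isClosed_ker fun a b k hd => hn a b k hd) hx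

/-- Subtracting the orthogonal projection `w` onto `H(O)` leaves components that lie in the fibres
and are orthogonal to them. -/
theorem mem_scriSubspace_iff {O : Set ScriPlus} (hO : IsOpen O)
    (hconn : ∀ n, (slice O n).OrdConnected) (ξ : ScriSpace) :
    ξ ∈ scriSubspace O ↔ ∀ᵐ n ∂sphereMeasure, component ξ n ∈ fibre O n := by
  refine ⟨component_mem_fibre, fun h => ?_⟩
  have : CompleteSpace (scriSubspace O) :=
    (Submodule.isClosed_topologicalClosure _).completeSpace_coe
  obtain ⟨w, hw, hort⟩ :=
    Submodule.HasOrthogonalProjection.exists_orthogonal (K := scriSubspace O) ξ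
  have h0 : ξ - w = 0 := by
    apply eq_zero_of_component_eq_zero
    filter_upwards [component_mem_orthogonal hO hconn fun η hη =>
      hort η (Submodule.le_topologicalClosure _ hη), h, component_mem_fibre hw,
      component_sub ξ w] with n h1 h2 h3 h4
    refine inner_self_eq_zero.1 (h1 _ ?_)
    rw [h4]
    exact sub_mem h2 h3
  rwa [sub_eq_zero.1 h0]

/-- The fundamental sequence of sections of the field of fibres. -/
theorem exists_fundamental_sequence {O : Set ScriPlus} (hO : IsOpen O)
    (hconn : ∀ n, (slice O n).OrdConnected) :
    ∃ e : ℕ → ScriSpace, (∀ k, e k ∈ scriSubspace O) ∧ ∀ᵐ n ∂sphereMeasure,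
      fibre O n = (Submodule.span ℝ (range fun k => component (e k) n)).topologicalClosure := by
  classical
  -- Cutting off by an indicator loses smoothness, but the fibre criterion still places the product
  -- in `H(O)`.
  let g : ℚ × ℚ × ℕ → S2 → ℝ := fun i => (directions O i.1 i.2.1).indicator fun _ => 1
  have hg : ∀ i, Measurable (g i) := fun i =>
    measurable_const.indicator (isOpen_directions hO _ _).measurableSet
  have hC : ∀ i n, |g i n| ≤ 1 := by
    intro i n
    by_cases hn : n ∈ directions O i.1 i.2.1 <;> simp [g, hn]
  let e : ℚ × ℚ × ℕ → ScriSpace := fun i =>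
    (memLp_tensor (testSeq i.1 i.2.1 i.2.2) (hg i) (hC i)).toLp
  have he : ∀ i, ∀ᵐ n ∂sphereMeasure, component (e i) n = g i n • testSeq i.1 i.2.1 i.2.2 :=
    fun i => component_tensor _ (hg i) (hC i)
  have hmem : ∀ i n, g i n • testSeq i.1 i.2.1 i.2.2 ∈ fibre O n := by
    intro i n
    by_cases hn : n ∈ directions O i.1 i.2.1
    · exact Submodule.smul_mem _ _ (testSeq_mem_fibre hn _)
    · simp [g, hn]
  let q := (Denumerable.eqv (ℚ × ℚ × ℕ)).symm
  refine ⟨fun k => e (q k), fun k => ?_, ?_⟩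
  · rw [mem_scriSubspace_iff hO hconn]
    filter_upwards [he (q k)] with n hn
    rw [hn]
    exact hmem _ _
  · filter_upwards [ae_all_iff.2 he] with n hn
    apply le_antisymm
    · refine fibre_le_of_testSeq_mem hO (hconn n) (Submodule.isClosed_topologicalClosure _)
        fun a b k hd => Submodule.le_topologicalClosure _ (Submodule.subset_span ?_)
      refine ⟨q.symm (a, b, k), ?_⟩
      simp only [Equiv.apply_symm_apply, hn]
      simp [g, hd]
    · refine Submodule.topologicalClosure_minimal _ (Submodule.span_le.2 ?_) (isClosed_fibre O n)
      rintro _ ⟨k, rfl⟩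
      simp only [hn]
      exact hmem _ _

/-! ### Separation and cyclicity from the fibres. -/

theorem isSeparating_of_fibre {O : Set ScriPlus}
    (h : ∀ n, IsSeparating (fibre O n)) : IsSeparating (scriSubspace O) := by
  intro x hx y hy hxy
  apply eq_zero_of_component_eq_zero
  filter_upwards [component_mem_fibre hx, component_mem_fibre hy, component_smul Complex.I y]
    with n h1 h2 h3
  rw [← hxy] at h3
  exact h n _ h1 _ h2 h3

theorem isCyclic_of_slice_nonempty {O : Set ScriPlus} (hO : IsOpen O)
    (hconn : ∀ n, (slice O n).OrdConnected)
    (hne : ∀ᵐ n ∂sphereMeasure, (slice O n).Nonempty) : IsCyclic (scriSubspace O) := by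
  -- `H + iH` contains the complex span of `H`, whose density can be read off its orthogonal
  -- complement.
  let L : Submodule ℂ ScriSpace := Submodule.span ℂ (scriSubspace O : Set ScriSpace)
  have hL : (L : Set ScriSpace) ⊆
      {z | ∃ x ∈ scriSubspace O, ∃ y ∈ scriSubspace O, z = x + Complex.I • y} := by
    intro z hz
    induction hz using Submodule.span_induction with
    | mem x hx => exact ⟨x, hx, 0, zero_mem _, by simp⟩
    | zero => exact ⟨0, zero_mem _, 0, zero_mem _, by simp⟩
    | add z w _ _ hz hw =>
      obtain ⟨x, hx, y, hy, rfl⟩ := hz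
      obtain ⟨x', hx', y', hy', rfl⟩ := hw
      exact ⟨x + x', add_mem hx hx', y + y', add_mem hy hy', by rw [smul_add]; abel⟩
    | smul c z _ hz =>
      obtain ⟨x, hx, y, hy, rfl⟩ := hz
      refine ⟨c.re • x - c.im • y, sub_mem (Submodule.smul_mem _ _ hx) (Submodule.smul_mem _ _ hy),
        c.re • y + c.im • x, add_mem (Submodule.smul_mem _ _ hy) (Submodule.smul_mem _ _ hx), ?_⟩
      have hr : ∀ (r : ℝ) (v : ScriSpace), r • v = (r : ℂ) • v := fun r v => rfl
      simp only [hr]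
      conv_lhs => rw [← Complex.re_add_im c]
      have hI : Complex.I * Complex.I = -1 := Complex.I_mul_I
      simp only [smul_add, add_smul, smul_smul, add_mul]
      rw [show ((c.im : ℂ) * Complex.I * Complex.I) = -(c.im : ℂ) by rw [mul_assoc, hI]; ring,
        neg_smul, mul_comm (c.re : ℂ) Complex.I, mul_comm (c.im : ℂ) Complex.I]
      abel
  have hdense : Dense (L : Set ScriSpace) := by
    rw [Submodule.dense_iff_topologicalClosure_eq_top, Submodule.topologicalClosure_eq_top_iff,
      Submodule.eq_bot_iff]
    intro ξ hξ
    have h0 : ∀ η ∈ scriTestSpace O, (inner ℂ η ξ : ℂ) = 0 := fun η hη =>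
      hξ η (Submodule.subset_span (Submodule.le_topologicalClosure _ hη))
    apply eq_zero_of_component_eq_zero
    -- Real orthogonality is used for both `ξ` and `iξ`, which together give complex orthogonality
    -- in the fibres; totality then applies.
    filter_upwards [
      component_mem_orthogonal hO hconn (ξ := ξ) fun η hη => by
        rw [real_inner_eq_re_inner, h0 η hη, Complex.zero_re],
      component_mem_orthogonal hO hconn (ξ := Complex.I • ξ) fun η hη => by
        rw [real_inner_eq_re_inner, inner_smul_right, h0 η hη, mul_zero, Complex.zero_re],
      component_smul Complex.I ξ, hne] with n h1 h2 h3 hne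
    refine eq_zero_of_inner_eq_zero (isOpen_slice hO n) hne fun x hx => ?_
    have hx' := Submodule.le_topologicalClosure _ hx
    have h4 := h1 x hx'
    have h5 := h2 x hx'
    rw [real_inner_comm, real_inner_eq_re_inner] at h4 h5
    rw [h3, inner_smul_right] at h5
    exact Complex.ext h4 (by simpa using h5)
  exact hdense.mono hL

/-! ### Translations -/

/-- On one ray the phase is a translation by a constant, which preserves test functions and norms.
-/
theorem mem_topologicalClosure_translate {I : Set ℝ} {x y : CurrentSpace} {c : ℝ}
    (hy : y =ᵐ[energyMeasure] fun E => Complex.exp (Complex.I * E * c) * x E)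
    (hx : x ∈ (currentTestSpace I).topologicalClosure) :
    y ∈ (currentTestSpace {u | u - c ∈ I}).topologicalClosure := by
  change y ∈ closure _
  rw [Metric.mem_closure_iff]
  intro ε hε
  obtain ⟨z, ⟨f, hf, hz⟩, hxz⟩ := Metric.mem_closure_iff.1 hx ε hε
  refine ⟨testVector (hf.comp_sub c), testVector_mem _, ?_⟩
  rw [dist_eq_norm] at hxz ⊢
  refine lt_of_le_of_lt (Lp.norm_le_norm_of_ae_le ?_) hxz
  filter_upwards [hy, hz, testVector_coe (hf.comp_sub c), Lp.coeFn_sub x z,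
    Lp.coeFn_sub y (testVector (hf.comp_sub c))] with E h1 h2 h3 h4 h5
  rw [h5, h4, Pi.sub_apply, Pi.sub_apply, h1, h3, h2, fourier_comp_sub, ← mul_sub, norm_mul,
    norm_exp_I_mul]
  simp

theorem component_translation_mem (C : C(S2, ℝ)) {ξ : ScriSpace} {I : S2 → Set ℝ}
    (h : ∀ᵐ n ∂sphereMeasure, component ξ n ∈ (currentTestSpace (I n)).topologicalClosure) :
    ∀ᵐ n ∂sphereMeasure, component (translation C ξ) n ∈
      (currentTestSpace {u | u - C n ∈ I n}).topologicalClosure := by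
  filter_upwards [h, component_coe ξ, component_coe (translation C ξ),
    ae_slice (memLp_phase_mul C ξ).coeFn_toLp] with n h1 h2 h3 h4
  refine mem_topologicalClosure_translate ?_ h1
  filter_upwards [h2, h3, h4] with E h2 h3 h4
  rw [h3, h2]
  exact h4

/-! ### Translated strips -/

theorem mem_shift_strip {c₁ c₂ : EReal} {A : Set S2} {C : S2 → ℝ} {p : ScriPlus} :
    p ∈ shift C (strip c₁ c₂ A) ↔ p.1 - C p.2 ∈ interval c₁ c₂ ∧ p.2 ∈ A := by
  constructor
  · rintro ⟨q, ⟨h1, h2⟩, rfl⟩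
    exact ⟨by simpa using h1, h2⟩
  · rintro ⟨h1, h2⟩
    exact ⟨(p.1 - C p.2, p.2), ⟨h1, h2⟩, by simp⟩

theorem isOpen_interval (c₁ c₂ : EReal) : IsOpen (interval c₁ c₂) :=
  isOpen_Ioo.preimage continuous_coe_real_ereal

theorem isOpen_shift_strip (c₁ c₂ : EReal) {A : Set S2} (hA : IsOpen A) (C : C(S2, ℝ)) :
    IsOpen (shift C (strip c₁ c₂ A)) := by
  have h : shift C (strip c₁ c₂ A) =
      (fun p : ScriPlus => p.1 - C p.2) ⁻¹' interval c₁ c₂ ∩ Prod.snd ⁻¹' A := by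
    ext p
    exact mem_shift_strip
  rw [h]
  exact ((isOpen_interval c₁ c₂).preimage (by fun_prop)).inter (hA.preimage continuous_snd)

theorem sub_mem_interval_iff {c₁ c₂ : EReal} {c u : ℝ} :
    u - c ∈ interval c₁ c₂ ↔ u ∈ interval (c₁ + c) (c₂ + c) := by
  have h1 : c₁ < ((u - c : ℝ) : EReal) ↔ c₁ + (c : EReal) < u := by
    induction c₁ with
    | bot => simp [-EReal.coe_sub, EReal.bot_lt_coe]
    | top => simp
    | coe x => norm_cast; exact lt_sub_iff_add_lt
  have h2 : ((u - c : ℝ) : EReal) < c₂ ↔ (u : EReal) < c₂ + (c : EReal) := by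
    induction c₂ with
    | bot => simp
    | top => simp [-EReal.coe_sub, EReal.coe_lt_top]
    | coe x => norm_cast; exact sub_lt_iff_lt_add
  exact and_congr h1 h2

theorem slice_shift_strip_of_mem {c₁ c₂ : EReal} {A : Set S2} {C : S2 → ℝ} {n : S2}
    (hn : n ∈ A) : slice (shift C (strip c₁ c₂ A)) n = interval (c₁ + C n) (c₂ + C n) := by
  ext u
  rw [← sub_mem_interval_iff]
  exact mem_shift_strip.trans (and_iff_left hn)

theorem slice_shift_strip_of_notMem {c₁ c₂ : EReal} {A : Set S2} {C : S2 → ℝ} {n : S2}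
    (hn : n ∉ A) : slice (shift C (strip c₁ c₂ A)) n = ∅ := by
  ext u
  exact iff_of_false (fun h => hn (mem_shift_strip.1 h).2) (notMem_empty u)

theorem ordConnected_interval (c₁ c₂ : EReal) : (interval c₁ c₂).OrdConnected :=
  ⟨fun _ hx _ hy _ hz => ⟨hx.1.trans_le (EReal.coe_le_coe_iff.2 hz.1),
    (EReal.coe_le_coe_iff.2 hz.2).trans_lt hy.2⟩⟩

theorem ordConnected_slice_shift_strip (c₁ c₂ : EReal) (A : Set S2) (C : S2 → ℝ) (n : S2) :
    (slice (shift C (strip c₁ c₂ A)) n).OrdConnected := by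
  by_cases hn : n ∈ A
  · rw [slice_shift_strip_of_mem hn]
    exact ordConnected_interval _ _
  · rw [slice_shift_strip_of_notMem hn]
    exact ordConnected_empty

theorem fibre_shift_strip_of_mem {c₁ c₂ : EReal} {A : Set S2} {C : S2 → ℝ} {n : S2}
    (hn : n ∈ A) : fibre (shift C (strip c₁ c₂ A)) n = currentSubspace (c₁ + C n) (c₂ + C n) := by
  rw [fibre, slice_shift_strip_of_mem hn, currentSubspace]

theorem fibre_shift_strip_of_notMem {c₁ c₂ : EReal} {A : Set S2} {C : S2 → ℝ} {n : S2}
    (hn : n ∉ A) : fibre (shift C (strip c₁ c₂ A)) n = ⊥ := by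
  rw [fibre, slice_shift_strip_of_notMem hn, currentTestSpace_empty]
  exact (isClosed_singleton (x := (0 : CurrentSpace))).submodule_topologicalClosure_eq

/-- Off `A` the slice is empty and the fibre zero, so the fibre criterion already encodes extension
by zero. -/
theorem isRealDirectIntegral_shift_strip (c₁ c₂ : EReal) {A : Set S2} (hA : IsOpen A)
    (C : C(S2, ℝ)) :
    IsRealDirectIntegral A (fun n => currentSubspace (c₁ + (C n : EReal)) (c₂ + (C n : EReal)))
      (scriSubspace (shift C (strip c₁ c₂ A))) := by
  have hO := isOpen_shift_strip c₁ c₂ hA C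
  have hconn := ordConnected_slice_shift_strip c₁ c₂ A C
  constructor
  · obtain ⟨e, he, h⟩ := exists_fundamental_sequence hO hconn
    refine ⟨e, he, ?_⟩
    filter_upwards [h] with n hn hnA
    rw [← hn, fibre_shift_strip_of_mem hnA]
  · intro ξ
    rw [mem_scriSubspace_iff hO hconn]
    refine Filter.eventually_congr (.of_forall fun n => ?_)
    by_cases hn : n ∈ A
    · simp [hn, fibre_shift_strip_of_mem hn]
    · simp [hn, fibre_shift_strip_of_notMem hn]

/-! ### Separating and standard subspaces of translated strips. -/

theorem interval_nonempty {c₁ c₂ : EReal} (h : c₁ < c₂) : (interval c₁ c₂).Nonempty := by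
  obtain ⟨q, h1, h2⟩ := EReal.exists_rat_btwn_of_lt h
  exact ⟨q, h1, h2⟩

/-- A point missed by the interval lies on one side of it, and so does an entire open half-line. -/
theorem exists_open_disjoint_interval {c₁ c₂ : EReal}
    (hne : interval c₁ c₂ ≠ univ) :
    ∃ J : Set ℝ, IsOpen J ∧ J.Nonempty ∧ Disjoint J (interval c₁ c₂) := by
  obtain ⟨u, hu⟩ := (ne_univ_iff_exists_notMem _).1 hne
  have : (u : EReal) ≤ c₁ ∨ c₂ ≤ (u : EReal) := by
    by_contra! hlt
    exact hu hlt
  rcases this with h1 | h1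
  · refine ⟨Iio u, isOpen_Iio, nonempty_Iio, disjoint_left.2 fun x hx hxi => ?_⟩
    exact (hxi.1.trans (EReal.coe_lt_coe_iff.2 hx)).not_ge h1
  · refine ⟨Ioi u, isOpen_Ioi, nonempty_Ioi, disjoint_left.2 fun x hx hxi => ?_⟩
    exact ((EReal.coe_lt_coe_iff.2 hx).trans hxi.2).not_ge h1

theorem isSeparating_bot : IsSeparating (⊥ : Submodule ℝ CurrentSpace) :=
  fun _ hx _ _ _ => hx

theorem isSeparating_shift_strip {c₁ c₂ : EReal} (hne : interval c₁ c₂ ≠ univ)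
    (A : Set S2) (C : S2 → ℝ) : IsSeparating (scriSubspace (shift C (strip c₁ c₂ A))) := by
  refine isSeparating_of_fibre fun n => ?_
  by_cases hn : n ∈ A
  · obtain ⟨J, hJ, ⟨v, hv⟩, hd⟩ := exists_open_disjoint_interval hne
    rw [fibre, slice_shift_strip_of_mem hn]
    refine isSeparating_of_disjoint (J := {u | u - C n ∈ J}) (hJ.preimage (by fun_prop))
      ⟨v + C n, by simpa using hv⟩ (disjoint_left.2 fun u hu hu' => ?_)
    exact disjoint_left.1 hd hu (sub_mem_interval_iff.2 hu')
  · rw [fibre_shift_strip_of_notMem hn]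
    exact isSeparating_bot

theorem isStandard_shift_strip {c₁ c₂ : EReal} (h : c₁ < c₂) (hne : interval c₁ c₂ ≠ univ)
    {A : Set S2} (hA : IsOpen A) (hnull : sphereMeasure Aᶜ = 0) (C : C(S2, ℝ)) :
    IsStandard (scriSubspace (shift C (strip c₁ c₂ A))) := by
  refine ⟨Submodule.isClosed_topologicalClosure _, ?_, isSeparating_shift_strip hne A C⟩
  refine isCyclic_of_slice_nonempty (isOpen_shift_strip c₁ c₂ hA C)
    (ordConnected_slice_shift_strip c₁ c₂ A C) ?_
  filter_upwards [(mem_ae_iff.2 hnull : ∀ᵐ n ∂sphereMeasure, n ∈ A)] with n hn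
  rw [slice_shift_strip_of_mem hn]
  obtain ⟨u, hu⟩ := interval_nonempty h
  exact ⟨u + C n, sub_mem_interval_iff.1 (by simpa using hu)⟩

/-! ### Half-strips and the action of distorted translations. -/

theorem shift_zero (O : Set ScriPlus) : shift (0 : C(S2, ℝ)) O = O := by
  simp [shift]

theorem halfStrip_eq_shift (C : S2 → ℝ) : halfStrip C = shift C (strip 0 ⊤ univ) := by
  ext p
  rw [mem_shift_strip]
  simp [halfStrip, interval, -EReal.coe_sub, EReal.coe_lt_top]

/-- Argued on components, since `C` need not be smooth. The initial shift `D` lets the same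
statement serve `T_C` and its inverse. -/
theorem translation_mem_shift_strip (c₁ c₂ : EReal) {A : Set S2} (hA : IsOpen A)
    (C D : C(S2, ℝ)) {ξ : ScriSpace} (hξ : ξ ∈ scriSubspace (shift D (strip c₁ c₂ A))) :
    translation C ξ ∈ scriSubspace (shift (D + C : C(S2, ℝ)) (strip c₁ c₂ A)) := by
  rw [mem_scriSubspace_iff (isOpen_shift_strip c₁ c₂ hA _)
    (ordConnected_slice_shift_strip c₁ c₂ A _)]
  have hs : ∀ n, slice (shift (D + C : C(S2, ℝ)) (strip c₁ c₂ A)) n =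
      {u | u - C n ∈ slice (shift D (strip c₁ c₂ A)) n} := by
    intro n
    ext u
    change (u, n) ∈ shift _ _ ↔ (u - C n, n) ∈ shift _ _
    rw [mem_shift_strip, mem_shift_strip]
    simp [sub_sub, add_comm]
  simp only [fibre, hs]
  exact component_translation_mem C (component_mem_fibre hξ)

theorem translation_image_strip (c₁ c₂ : EReal) {A : Set S2} (hA : IsOpen A) (C : C(S2, ℝ)) :
    (scriSubspace (shift C (strip c₁ c₂ A)) : Set ScriSpace) =
      translation C '' (scriSubspace (strip c₁ c₂ A)) := by
  apply Subset.antisymm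
  · intro ξ hξ
    refine ⟨translation (-C) ξ, ?_, (translation C).right_inv ξ⟩
    have h := translation_mem_shift_strip c₁ c₂ hA (-C) C hξ
    rwa [add_neg_cancel, shift_zero] at h
  · rintro _ ⟨ξ, hξ, rfl⟩
    have h := translation_mem_shift_strip c₁ c₂ hA C 0 (ξ := ξ) (by rwa [shift_zero])
    rwa [zero_add] at h

theorem interval_zero_top_ne_univ : interval 0 ⊤ ≠ univ := fun h => by
  have : (0 : ℝ) ∈ interval 0 ⊤ := h ▸ mem_univ _
  exact lt_irrefl _ this.1

end Scri

end

open Scri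

theorem mainTheorem6 :
    (∀ (c₁ c₂ : EReal) (A : Set S2), c₁ < c₂ → IsOpen A →
      IsRealDirectIntegral A (fun _ => currentSubspace c₁ c₂) (scriSubspace (strip c₁ c₂ A)) ∧
      (interval c₁ c₂ ≠ Set.univ →
        IsSeparating (scriSubspace (strip c₁ c₂ A)) ∧
        (sphereMeasure Aᶜ = 0 → IsStandard (scriSubspace (strip c₁ c₂ A))))) ∧
    (∀ (C : C(S2, ℝ)) (c₁ c₂ : EReal) (A : Set S2), c₁ < c₂ → IsOpen A →
      IsRealDirectIntegral A (fun n => currentSubspace (c₁ + (C n : EReal)) (c₂ + (C n : EReal)))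
        (scriSubspace (shift C (strip c₁ c₂ A))) ∧
      (interval c₁ c₂ ≠ Set.univ →
        IsSeparating (scriSubspace (shift C (strip c₁ c₂ A))) ∧
        (sphereMeasure Aᶜ = 0 → IsStandard (scriSubspace (shift C (strip c₁ c₂ A)))))) ∧
    (∀ C : C(S2, ℝ),
      (scriSubspace (halfStrip C) : Set ScriSpace) =
        translation C '' (scriSubspace (strip 0 ⊤ Set.univ)) ∧
      IsRealDirectIntegral Set.univ (fun n => currentSubspace (C n : EReal) ⊤)
        (scriSubspace (halfStrip C)) ∧
      IsStandard (scriSubspace (halfStrip C))) := by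
  have main : ∀ (C : C(S2, ℝ)) (c₁ c₂ : EReal) (A : Set S2), c₁ < c₂ → IsOpen A →
      IsRealDirectIntegral A (fun n => currentSubspace (c₁ + (C n : EReal)) (c₂ + (C n : EReal)))
        (scriSubspace (shift C (strip c₁ c₂ A))) ∧
      (interval c₁ c₂ ≠ Set.univ →
        IsSeparating (scriSubspace (shift C (strip c₁ c₂ A))) ∧
        (sphereMeasure Aᶜ = 0 → IsStandard (scriSubspace (shift C (strip c₁ c₂ A))))) :=
    fun C c₁ c₂ A h hA => ⟨isRealDirectIntegral_shift_strip c₁ c₂ hA C, fun hne =>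
      ⟨isSeparating_shift_strip hne A C, fun hnull =>
        isStandard_shift_strip h hne hA hnull C⟩⟩
  refine ⟨fun c₁ c₂ A h hA => ?_, main, fun C => ?_⟩
  · simpa only [shift_zero, ContinuousMap.zero_apply, EReal.coe_zero, add_zero]
      using main 0 c₁ c₂ A h hA
  · have h := main C 0 ⊤ Set.univ EReal.zero_lt_top isOpen_univ
    rw [halfStrip_eq_shift]
    refine ⟨translation_image_strip 0 ⊤ isOpen_univ C, ?_,
      (h.2 interval_zero_top_ne_univ).2 (by simp)⟩
    simpa only [zero_add, EReal.top_add_coe] using h.1
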